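/- All digraphs are finite, without loops and without parallel arcs (digons, i.e. pairs of opposite arcs, are allowed). For a digraph $D$ write $d_D(v)=(d_D^+(v),d_D^-(v))$ for the pair of out- and in-degree of $v$, and $\delta^\pm(D)$, $\Delta^\pm(D)$ for the minimum and maximum out- /in-degrees ($0$ if $D$ is empty), $\delta(D)=(\delta^+(D),\delta^-(D))$, $\Delta(D)=(\Delta^+(D),\Delta^-(D))$; pairs of integers are compared and multiplied by integers coordinatewise. $D^\pm(G)$ is the digraph obtained from a simple graph $G$ by replacing each edge by a digon; a bidirected cycle is a digraph $D^\pm(C_n)$ with $n\ge 3$. An antidirected cycle is a digraph whose underlying graph is a cycle and each of whose vertices is a source or a sink. $D$ is connected if its underlying graph is; a separating vertex of $D$ is a vertex $v$ such that $D-v$ has at least two components; a block of $D$ is a maximal connected subdigraph that has no separating vertex. Let $\mathcal D$ be a reliable digraph property: an isomorphism-closed class of digraphs that contains a nonempty digraph, does not contain all digraphs, and is closed under induced subdigraphs and under disjoint unions. Let $\mathrm{CR}(\mathcal D)$ be the class of digraphs $D\notin\mathcal D$ with $D-v\in\mathcal D$ for all $v\in V(D)$, and let $d(\mathcal D)=(d^+(\mathcal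 D),d^-(\mathcal D))$ with $d^\pm(\mathcal D)=\min\{\delta^\pm(D): D\in\mathrm{CR}(\mathcal D)\}$. A $\mathcal D$-dibrick is a connected digraph $B$ such that (up to isomorphism) $B=D^\pm(K_n)$ with $n\ge1$, or $B=D^\pm(C_n)$ with $n\ge3$ odd, or $B\in\mathcal D$ and $\Delta(B)\le d(\mathcal D)$, or $B\in\mathrm{CR}(\mathcal D)$ and $d_B^+(v)=d_B^-(v)=d^+(\mathcal D)=d^-(\mathcal D)$ for all $v\in V(B)$. A cover of $D$ is a pair $(X,H)$ of a digraph $H$ and pairwise disjoint independent sets $X_v$ of $H$ ($v\in V(D)$) with $V(H)=\bigcup_v X_v$ such that, for distinct $u,v$, the arcs of $H$ from $X_u$ to $X_v$ form a (possibly empty) matching if $uv\in A(D)$, and there are none if $uv\notin A(D)$. A $\mathcal D$-transversal of $(X,H)$ is a set $T\subseteq V(H)$ with $|T\cap X_v|=1$ for all $v$ and $H[T]\in\mathcal D$. Let - $\chi(D:\mathcal D)$ be the least $k$ such that $V(D)$ can be colored with $k$ colors so that every color class induces a member of $\mathcal D$; - $\chi_\ell(D:\mathcal D)$ be the least $k$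 such that, for every assignment of lists $L(v)$ with $|L(v)|\ge k$ for all $v$, there is a coloring $\varphi$ with $\varphi(v)\in L(v)$ for all $v$ all of whose color classes induce members of $\mathcal D$; - $\chi_{\rm DP}(D:\mathcal D)$ be the least $k$ such that every cover $(X,H)$ of $D$ with $|X_v|\ge k$ for all $v$ has a $\mathcal D$-transversal. For $\xi\in\{\chi,\chi_\ell,\chi_{\rm DP}\}$, $D$ is $(\mathcal D,\xi,k)$-critical if $\xi(D:\mathcal D)=k$ and $\xi(D':\mathcal D)<k$ for every proper induced subdigraph $D'$ of $D$. **Corollary.** Let $\mathcal D$ be a reliable digraph property with $d(\mathcal D)\ge(1,1)$ and let $k\ge0$ be an integer. (a) If $D$ is $(\mathcal D,\chi_{\rm DP},k+1)$-critical, then $\delta(D)\ge k\cdot d(\mathcal D)$. Moreover, if $U=\{v\in V(D): d_D(v)=k\cdot d(\mathcal D)\}$, then every block of $D[U]$ is a $\mathcal D$-dibrick, or a bidirected cycle of even order, or an antidirected cycle. (b) If $D$ is $(\mathcal D,\chi,k+1)$-critical or $(\mathcal D,\chi_\ell,k+1)$-critical, then $\delta(D)\ge k\cdot d(\mathcal D)$.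 Moreover, with $U$ as in (a), every block of $D[U]$ is a $\mathcal D$-dibrick. (c) Every digraph $D$ satisfies $$\chi_{\rm DP}(D:\mathcal D)\le\min\left\{\frac{\Delta^+(D)}{d^+(\mathcal D)},\frac{\Delta^-(D)}{d^-(\mathcal D)}\right\}+1 .$$ -/

import Mathlib

universe u

/-- A finite digraph without loops and without parallel arcs (digons are allowed). -/
structure FinDigraph : Type (u + 1) where
  V : Type u
  [finite : Finite V]
  graph : Digraph V
  loopless : ∀ v, ¬ graph.Adj v v

namespace FinDigraph

attribute [instance] FinDigraph.finite

/-- `D.Adj v w` says that `vw` is an arc of `D`. -/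
abbrev Adj (D : FinDigraph.{u}) : D.V → D.V → Prop := D.graph.Adj

/-- The subdigraph `D[S]` induced by a vertex set `S`. -/
def induce (D : FinDigraph.{u}) (S : Set D.V) : FinDigraph.{u} where
  V := S
  graph := ⟨fun v w => D.Adj v w⟩
  loopless v := D.loopless v

/-- `D - v`. -/
def del (D : FinDigraph.{u}) (v : D.V) : FinDigraph.{u} := D.induce {v}ᶜ

/-- The (vertex) disjoint union of two digraphs. -/
def disjUnion (D E : FinDigraph.{u}) : FinDigraph.{u} where
  V := D.V ⊕ E.V
  graph := ⟨Sum.LiftRel D.Adj E.Adj⟩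
  loopless := by
    rintro (v | v) h
    · exact D.loopless v (by simpa using h)
    · exact E.loopless v (by simpa using h)

/-- The bidirected graph `D^±(G)`: every edge of the simple graph `G` is replaced by a digon. -/
def bidirected {V : Type u} [Finite V] (G : SimpleGraph V) : FinDigraph.{u} where
  V := V
  graph := ⟨G.Adj⟩
  loopless _ := G.irrefl

/-- The underlying (simple) graph: `v` and `w` are adjacent iff `vw` or `wv` is an arc. -/
def underlying (D : FinDigraph.{u}) : SimpleGraph D.V := D.graph.toSimpleGraphInclusive

/-- A digraph is connected if its underlying graph is (in particular it is nonempty). -/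
def IsConnected (D : FinDigraph.{u}) : Prop := D.underlying.Connected

/-! ### Degrees -/

/-- The out-degree `d⁺(v)`. -/
noncomputable def outDeg (D : FinDigraph.{u}) (v : D.V) : ℕ := {w | D.Adj v w}.ncard

/-- The in-degree `d⁻(v)`. -/
noncomputable def inDeg (D : FinDigraph.{u}) (v : D.V) : ℕ := {w | D.Adj w v}.ncard

/-- The degree `d(v) = (d⁺(v), d⁻(v))`; pairs are ordered componentwise. -/
noncomputable def deg (D : FinDigraph.{u}) (v : D.V) : ℕ × ℕ := (D.outDeg v, D.inDeg v)

/-! The following four numbers are `0` for the empty digraph. -/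

/-- The minimum out-degree `δ⁺(D)`. -/
noncomputable def minOutDeg (D : FinDigraph.{u}) : ℕ := ⨅ v, D.outDeg v

/-- The minimum in-degree `δ⁻(D)`. -/
noncomputable def minInDeg (D : FinDigraph.{u}) : ℕ := ⨅ v, D.inDeg v

/-- The maximum out-degree `Δ⁺(D)`. -/
noncomputable def maxOutDeg (D : FinDigraph.{u}) : ℕ := ⨆ v, D.outDeg v

/-- The maximum in-degree `Δ⁻(D)`. -/
noncomputable def maxInDeg (D : FinDigraph.{u}) : ℕ := ⨆ v, D.inDeg v

/-- `δ(D) = (δ⁺(D), δ⁻(D))`. -/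
noncomputable def minDeg (D : FinDigraph.{u}) : ℕ × ℕ := (D.minOutDeg, D.minInDeg)

/-- `Δ(D) = (Δ⁺(D), Δ⁻(D))`. -/
noncomputable def maxDeg (D : FinDigraph.{u}) : ℕ × ℕ := (D.maxOutDeg, D.maxInDeg)

/-! ### Blocks -/

/-- A (not necessarily induced) subdigraph of `D`. -/
structure Subdigraph (D : FinDigraph.{u}) where
  verts : Set D.V
  Adj : D.V → D.V → Prop
  adj_sub : ∀ {v w}, Adj v w → D.Adj v w
  tail_mem : ∀ {v w}, Adj v w → v ∈ verts
  head_mem : ∀ {v w}, Adj v w → w ∈ verts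

/-- A subdigraph, regarded as a digraph in its own right. -/
def Subdigraph.coe {D : FinDigraph.{u}} (B : D.Subdigraph) : FinDigraph.{u} where
  V := B.verts
  graph := ⟨fun v w => B.Adj v w⟩
  loopless v h := D.loopless v (B.adj_sub h)

/-- The subdigraph relation. -/
instance (D : FinDigraph.{u}) : LE D.Subdigraph where
  le A B := A.verts ⊆ B.verts ∧ ∀ v w, A.Adj v w → B.Adj v w

/-- `D - v` has at least two components. -/
def IsSeparating (D : FinDigraph.{u}) (v : D.V) : Prop :=
  Nontrivial (D.del v).underlying.ConnectedComponent

/-- A block of `D` is a maximal connected subdigraph that has no separating vertex. -/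
def IsBlock {D : FinDigraph.{u}} (B : D.Subdigraph) : Prop :=
  Maximal (fun A : D.Subdigraph => A.coe.IsConnected ∧ ∀ v, ¬ A.coe.IsSeparating v) B

/-! ### Digraph properties -/

/-- A reliable digraph property: a class of digraphs that is closed under isomorphism,
nontrivial, hereditary and additive. -/
structure IsReliable (P : Set FinDigraph.{u}) : Prop where
  iso : ∀ D E : FinDigraph.{u}, D ∈ P → Nonempty (D.Adj ≃r E.Adj) → E ∈ P
  exists_mem : ∃ D ∈ P, Nonempty D.V
  exists_notMem : ∃ D, D ∉ P
  hereditary : ∀ D ∈ P, ∀ S : Set D.V, D.induce S ∈ P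
  additive : ∀ D ∈ P, ∀ E ∈ P, D.disjUnion E ∈ P

/-- `CR(P)`: the digraphs outside of `P` all of whose vertex-deleted subdigraphs lie in `P`. -/
def CR (P : Set FinDigraph.{u}) : Set FinDigraph.{u} := {D | D ∉ P ∧ ∀ v, D.del v ∈ P}

/-- `d⁺(P)`, the least minimum out-degree of a member of `CR(P)`. -/
noncomputable def dPlus (P : Set FinDigraph.{u}) : ℕ := sInf (minOutDeg '' CR P)

/-- `d⁻(P)`, the least minimum in-degree of a member of `CR(P)`. -/
noncomputable def dMinus (P : Set FinDigraph.{u}) : ℕ := sInf (minInDeg '' CR P)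

/-- `d(P) = (d⁺(P), d⁻(P))`. -/
noncomputable def dPair (P : Set FinDigraph.{u}) : ℕ × ℕ := (dPlus P, dMinus P)

/-! ### Covers and coloring parameters -/

/-- The arcs with tail in `S` and head in `T`. -/
def arcsBetween (D : FinDigraph.{u}) (S T : Set D.V) : Set (D.V × D.V) :=
  {a | a.1 ∈ S ∧ a.2 ∈ T ∧ D.Adj a.1 a.2}

/-- A matching: a set of pairwise (vertex) disjoint arcs. -/
def IsMatching {V : Type u} (M : Set (V × V)) : Prop :=
  M.Pairwise fun a b => a.1 ≠ b.1 ∧ a.1 ≠ b.2 ∧ a.2 ≠ b.1 ∧ a.2 ≠ b.2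

/-- A cover `(X, H)` of `D`. -/
structure Cover (D : FinDigraph.{u}) where
  H : FinDigraph.{u}
  X : D.V → Set H.V
  disjoint : ∀ u v, u ≠ v → Disjoint (X u) (X v)
  iUnion_eq : ⋃ v, X v = Set.univ
  indep : ∀ v, H.arcsBetween (X v) (X v) = ∅
  matching : ∀ u v, u ≠ v → D.Adj u v → IsMatching (H.arcsBetween (X u) (X v))
  noArcs : ∀ u v, u ≠ v → ¬ D.Adj u v → H.arcsBetween (X u) (X v) = ∅

/-- `(X, H)` is a `k`-cover: `|X_v| ≥ k` for all `v`. -/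
def Cover.IsKCover {D : FinDigraph.{u}} (C : D.Cover) (k : ℕ) : Prop := ∀ v, k ≤ (C.X v).ncard

/-- A transversal meets every `X_v` in exactly one vertex. -/
def Cover.IsTransversal {D : FinDigraph.{u}} (C : D.Cover) (T : Set C.H.V) : Prop :=
  ∀ v, (T ∩ C.X v).ncard = 1

/-- `D` admits a `P`-coloring with a set of `k` colors. -/
def Colorable (P : Set FinDigraph.{u}) (D : FinDigraph.{u}) (k : ℕ) : Prop :=
  ∃ φ : D.V → Fin k, ∀ c, D.induce (φ ⁻¹' {c}) ∈ P

/-- `D` admits a `(P, L)`-coloring whenever `L` is a `k`-assignment of `D`. -/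
def ListColorable (P : Set FinDigraph.{u}) (D : FinDigraph.{u}) (k : ℕ) : Prop :=
  ∀ (C : Type u) (L : D.V → Set C), (∀ v, (k : ℕ∞) ≤ (L v).encard) →
    ∃ φ : D.V → C, (∀ v, φ v ∈ L v) ∧ ∀ c, D.induce (φ ⁻¹' {c}) ∈ P

/-- Every `k`-cover of `D` has a `P`-transversal. -/
def DPColorable (P : Set FinDigraph.{u}) (D : FinDigraph.{u}) (k : ℕ) : Prop :=
  ∀ C : D.Cover, C.IsKCover k → ∃ T, C.IsTransversal T ∧ C.H.induce T ∈ P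

/-- The `P`-dichromatic number. -/
noncomputable def chi (P : Set FinDigraph.{u}) (D : FinDigraph.{u}) : ℕ :=
  sInf {k | Colorable P D k}

/-- The `P`-list-dichromatic number. -/
noncomputable def chiList (P : Set FinDigraph.{u}) (D : FinDigraph.{u}) : ℕ :=
  sInf {k | ListColorable P D k}

/-- The `P`-DP-dichromatic number. -/
noncomputable def chiDP (P : Set FinDigraph.{u}) (D : FinDigraph.{u}) : ℕ :=
  sInf {k | DPColorable P D k}

/-- `Crit(P, ξ, k)` for a parameter `ξ` (one of `chi P`, `chiList P`, `chiDP P`): the digraphs `D`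
with `ξ(D) = k` and `ξ(D') < k` for every proper induced subdigraph `D'`. -/
def Crit (ξ : FinDigraph.{u} → ℕ) (k : ℕ) : Set FinDigraph.{u} :=
  {D | ξ D = k ∧ ∀ S : Set D.V, S ≠ Set.univ → ξ (D.induce S) < k}

/-! ### The possible blocks -/

/-- `D` is (isomorphic to) a bidirected cycle of order `n`. -/
def IsBidirectedCycle (D : FinDigraph.{u}) (n : ℕ) : Prop :=
  3 ≤ n ∧ Nonempty (D.Adj ≃r (bidirected (SimpleGraph.cycleGraph n)).Adj)

/-- `D` is an antidirected cycle: its underlying graph is a cycle, and every vertex is a source or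
a sink. -/
def IsAntidirectedCycle (D : FinDigraph.{u}) : Prop :=
  (∃ n, 3 ≤ n ∧ Nonempty (D.underlying ≃g SimpleGraph.cycleGraph n)) ∧
    ∀ v, D.inDeg v = 0 ∨ D.outDeg v = 0

/-- `P`-dibricks.  (In the last alternative `D` is Eulerian, since `d⁺(v) = d⁻(v)`.) -/
def IsDibrick (P : Set FinDigraph.{u}) (D : FinDigraph.{u}) : Prop :=
  D.IsConnected ∧
    ((∃ n, 1 ≤ n ∧ Nonempty (D.Adj ≃r (bidirected (⊤ : SimpleGraph (Fin n))).Adj)) ∨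
      (∃ n, Odd n ∧ D.IsBidirectedCycle n) ∨
      (D ∈ P ∧ D.maxDeg ≤ dPair P) ∨
      (D ∈ CR P ∧ ∀ v, D.outDeg v = D.inDeg v ∧ D.inDeg v = dPlus P ∧ dPlus P = dMinus P))

end FinDigraph

/-!
Let `C = (X, H)` be a cover of `D` with `|X_v| ≥ k` that has no `P`-transversal, while every `D - v`
has a partial one.  Fix a partial transversal `φ` that leaves out only `v`; call `v` the *hole*.
Adding any `x ∈ X_v` creates a member of `CR(P)` through `x`, so `x` has at least `d(P)` neighbors
among the chosen vertices.  Since the arcs of the cover form matchings, these neighborhoods belong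
to disjoint sets of neighbors of `v`; hence `d_D(v) ≥ k · d(P)` (`FinDigraph.mul_sBound_le`).  If
equality holds, then every `x ∈ X_v` has *exactly* `d(P)` neighbors, and choosing `x` in place of a
neighbor `φ u` is again admissible: the hole moves from `v` to `u` (`FinDigraph.isGood_shift`).

These facts are all that is used to determine the blocks, and they are axiomatized as
`ShiftSystem`.  For a nonseparable set `S` of vertices of degree `k · d(P)` with the hole in `S`, the
*labels* at the hole are the colors of the hole that have a neighbor among the colors chosen on `S`.
Their number does not depend on the position of the hole (`ShiftSystem.ncard_labels_eq`), and if
there is an arc of `S` in a given direction at the hole, then every label has a neighbor in this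
direction (`ShiftSystem.signedLabels_eq_labels`).

If a block has only one label, its degrees are at most `d(P)`, and it is in `P`, or is itself a
member of `CR(P)` all of whose degrees are `d(P)` (`FinDigraph.isDibrick_of_sDeg_le`).  With two
or more labels, rotating the hole around cycles excludes theta-like configurations
(`ShiftSystem.false_of_theta`), in particular an induced `K₄` minus an edge.  It follows that a
vertex with two nonadjacent
neighbors of different labels has no further neighbor, and the block is an induced cycle
(`ShiftSystem.exists_isInducedCycle`), bidirected or antidirected because each direction occurs
at a vertex twice or not at all; otherwise all neighborhoods are cliques and the block is a
complete bidirected graph (`ShiftSystem.classification`).  In a cover that comes from lists, just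
two colors occur on such a cycle and they alternate away from the hole, so that its order is odd
(`ShiftSystem.odd_of_color`).

For the bound on `χ_DP`, a digraph that is not DP-`k`-colorable contains an induced subdigraph that
is minimal with this property, and the degree bound applies to it.
-/

/-! ### Nonseparable sets, induced paths and induced cycles in graphs -/

namespace SimpleGraph

variable {V : Type*} {G : SimpleGraph V}

/-- `a` and `b` are joined by a walk of `G` that stays in `R` (or are equal). -/
def LinkedIn (G : SimpleGraph V) (R : Set V) : V → V → Prop :=
  Relation.ReflTransGen fun a b => G.Adj a b ∧ a ∈ R ∧ b ∈ R

theorem LinkedIn.refl (R : Set V) (a : V) : G.LinkedIn R a a := Relation.ReflTransGen.refl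

theorem LinkedIn.trans {R : Set V} {a b c : V} (h : G.LinkedIn R a b) (h' : G.LinkedIn R b c) :
    G.LinkedIn R a c := Relation.ReflTransGen.trans h h'

theorem LinkedIn.symm {R : Set V} {a b : V} (h : G.LinkedIn R a b) : G.LinkedIn R b a := by
  induction h with
  | refl => exact LinkedIn.refl _ _
  | tail _ h ih => exact (Relation.ReflTransGen.single ⟨h.1.symm, h.2.2, h.2.1⟩).trans ih

theorem LinkedIn.mono {R S : Set V} (hRS : R ⊆ S) {a b : V} (h : G.LinkedIn R a b) :
    G.LinkedIn S a b :=
  Relation.ReflTransGen.mono (fun _ _ h => ⟨h.1, hRS h.2.1, hRS h.2.2⟩) _ _ h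

theorem Adj.linkedIn {R : Set V} {a b : V} (h : G.Adj a b) (ha : a ∈ R) (hb : b ∈ R) :
    G.LinkedIn R a b := Relation.ReflTransGen.single ⟨h, ha, hb⟩

/-- A property that holds at `a` and fails at `b` changes along an edge of a walk from `a` to `b`. -/
theorem LinkedIn.exists_adj_of_not {R : Set V} {a b : V} (h : G.LinkedIn R a b) {p : V → Prop}
    (ha : p a) (hb : ¬ p b) : ∃ c ∈ R, ∃ d ∈ R, G.Adj c d ∧ p c ∧ ¬ p d := by
  induction h with
  | refl => exact absurd ha hb
  | @tail c d _ h ih =>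
    by_cases hc : p c
    · exact ⟨c, h.2.1, d, h.2.2, h.1, hc, hb⟩
    · exact ih hc

/-- The set `S` induces a connected subgraph without separating vertices (or is empty). -/
structure IsNonsep (G : SimpleGraph V) (S : Set V) : Prop where
  linked : ∀ a ∈ S, ∀ b ∈ S, G.LinkedIn S a b
  linked_diff : ∀ x, ∀ a ∈ S, a ≠ x → ∀ b ∈ S, b ≠ x → G.LinkedIn (S \ {x}) a b

theorem Adj.isNonsep_pair {a b : V} (h : G.Adj a b) : G.IsNonsep {a, b} where
  linked := by
    rintro x (rfl | rfl) y (rfl | rfl)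
    · exact .refl _ _
    · exact h.linkedIn (by simp) (by simp)
    · exact h.symm.linkedIn (by simp) (by simp)
    · exact .refl _ _
  linked_diff := by
    rintro z x (rfl | rfl) hx y (rfl | rfl) hy
    · exact .refl _ _
    · exact h.linkedIn ⟨by simp, hx⟩ ⟨by simp, hy⟩
    · exact h.symm.linkedIn ⟨by simp, hx⟩ ⟨by simp, hy⟩
    · exact .refl _ _

theorem linkedIn_of_walk {R : Set V} {p : ℕ → V} {i j : ℕ} (hij : i ≤ j)
    (hadj : ∀ k, i ≤ k → k < j → G.Adj (p k) (p (k + 1)))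
    (hR : ∀ k, i ≤ k → k ≤ j → p k ∈ R) : G.LinkedIn R (p i) (p j) := by
  induction j, hij using Nat.le_induction with
  | base => exact .refl _ _
  | succ j hij ih =>
    refine (ih (fun k h1 h2 => hadj k h1 (by omega)) (fun k h1 h2 => hR k h1 (by omega))).trans ?_
    exact (hadj j hij (by omega)).linkedIn (hR j hij (by omega)) (hR _ (by omega) le_rfl)

/-- Attaching an ear to a nonseparable set keeps it nonseparable.  The ear `v, p 0, …, p n` may
meet `C` in interior vertices, too. -/
theorem IsNonsep.union_ear {C : Set V} (hC : G.IsNonsep C) {p : ℕ → V} {n : ℕ} {v : V}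
    (hadj : ∀ k, k < n → G.Adj (p k) (p (k + 1))) (hinj : Set.InjOn p (Set.Iic n))
    (hn : p n ∈ C) (hv : v ∈ C) (hpv : ∀ i ≤ n, p i ≠ v) (h0 : G.Adj v (p 0)) :
    G.IsNonsep (C ∪ p '' Set.Iic n) where
  linked := by
    have key : ∀ a ∈ C ∪ p '' Set.Iic n, G.LinkedIn (C ∪ p '' Set.Iic n) a (p n) := by
      rintro a (ha | ⟨i, hi, rfl⟩)
      · exact (hC.linked a ha _ hn).mono Set.subset_union_left
      · exact linkedIn_of_walk hi (fun k _ h => hadj k h) fun k _ h => Or.inr ⟨k, h, rfl⟩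
    exact fun a ha b hb => (key a ha).trans (key b hb).symm
  linked_diff := by
    intro x
    have key : ∀ a ∈ C ∪ p '' Set.Iic n, a ≠ x →
        ∃ c ∈ C, c ≠ x ∧ G.LinkedIn ((C ∪ p '' Set.Iic n) \ {x}) a c := by
      rintro a (ha | ⟨i, hi, rfl⟩) hax
      · exact ⟨a, ha, hax, .refl _ _⟩
      by_cases hj : ∃ j, i < j ∧ j ≤ n ∧ p j = x
      · obtain ⟨j, hij, hjn, rfl⟩ := hj
        refine ⟨v, hv, (hpv j hjn).symm, ?_⟩
        have h1 : ∀ k, 0 ≤ k → k ≤ i → p k ∈ (C ∪ p '' Set.Iic n) \ {p j} := fun k _ hk =>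
          ⟨Or.inr ⟨k, by simp at hi ⊢; omega, rfl⟩, fun h => by
            have := hinj (by simp at hi ⊢; omega) (by simpa using hjn) h
            omega⟩
        refine (linkedIn_of_walk (Nat.zero_le i)
          (fun k _ h => hadj k (by simp at hi; omega)) h1).symm.trans ?_
        exact h0.symm.linkedIn (h1 0 le_rfl (Nat.zero_le _)) ⟨Or.inl hv, (hpv j hjn).symm⟩
      · push Not at hj
        have h1 : ∀ k, i ≤ k → k ≤ n → p k ∈ (C ∪ p '' Set.Iic n) \ {x} := fun k hik hk =>
          ⟨Or.inr ⟨k, hk, rfl⟩, by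
            rcases hik.eq_or_lt with rfl | h
            · exact hax
            · exact hj k h hk⟩
        exact ⟨p n, hn, (h1 n hi le_rfl).2,
          linkedIn_of_walk hi (fun k _ h => hadj k h) h1⟩
    intro a ha hax b hb hbx
    obtain ⟨c, hc, hcx, h1⟩ := key a ha hax
    obtain ⟨c', hc', hcx', h2⟩ := key b hb hbx
    refine h1.trans (LinkedIn.trans ?_ h2.symm)
    exact (hC.linked_diff x c hc hcx c' hc' hcx').mono (Set.sdiff_subset_sdiff_left Set.subset_union_left)

/-- A vertex with two neighbors in a nonseparable set can be added to it. -/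
theorem IsNonsep.insert {C : Set V} (hC : G.IsNonsep C) {z v w : V} (hv : v ∈ C) (hw : w ∈ C)
    (hvw : v ≠ w) (hzv : G.Adj z v) (hzw : G.Adj z w) : G.IsNonsep (insert z C) := by
  have h := hC.union_ear (p := fun i => if i = 0 then z else w) (n := 1) (v := v)
    (by intro k hk; obtain rfl : k = 0 := by omega
        simpa using hzw)
    (by
      intro i hi j hj hij
      have : i = 0 ∨ i = 1 := by simp at hi; omega
      have : j = 0 ∨ j = 1 := by simp at hj; omega
      have := hzw.ne
      have := hzw.ne'
      rcases ‹i = 0 ∨ i = 1› with rfl | rfl <;> rcases ‹j = 0 ∨ j = 1› with rfl | rfl <;> simp_all)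
    (by simpa using hw) hv
    (by intro i _; by_cases hi : i = 0 <;> simp [hi, hzv.ne, hvw.symm])
    (by simpa using hzv.symm)
  convert h using 1
  ext y
  simp only [Set.mem_insert_iff, Set.mem_union, Set.mem_image, Set.mem_Iic]
  constructor
  · rintro (rfl | h)
    · exact Or.inr ⟨0, by simp, by simp⟩
    · exact Or.inl h
  · rintro (h | ⟨i, hi, rfl⟩)
    · exact Or.inr h
    · by_cases hi : i = 0 <;> simp [hi, hw]

/-- `p 0, …, p n` are distinct and induce a path of `G`, in this order; the values of `p` beyond `n`
do not matter. -/
structure IsInducedPath (G : SimpleGraph V) (p : ℕ → V) (n : ℕ) : Prop where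
  injOn : Set.InjOn p (Set.Iic n)
  adj_iff : ∀ i j, i ≤ n → j ≤ n → (G.Adj (p i) (p j) ↔ i + 1 = j ∨ j + 1 = i)

theorem IsInducedPath.adj_succ {p : ℕ → V} {n : ℕ} (h : G.IsInducedPath p n) {i : ℕ} (hi : i < n) :
    G.Adj (p i) (p (i + 1)) := (h.adj_iff i (i + 1) (by omega) (by omega)).2 (Or.inl rfl)

theorem IsInducedPath.ne {p : ℕ → V} {n : ℕ} (h : G.IsInducedPath p n) {i j : ℕ} (hi : i ≤ n)
    (hj : j ≤ n) (hij : i ≠ j) : p i ≠ p j := fun e => hij (h.injOn hi hj e)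

/-- A vertex `v` and a path between two neighbors of `v` form a nonseparable set. -/
theorem isNonsep_insert_walk {p : ℕ → V} {n : ℕ} {v : V}
    (hadj : ∀ k, k < n → G.Adj (p k) (p (k + 1))) (hinj : Set.InjOn p (Set.Iic n))
    (hpv : ∀ i ≤ n, p i ≠ v) (h0 : G.Adj v (p 0)) (hn : G.Adj v (p n)) :
    G.IsNonsep (insert v (p '' Set.Iic n)) := by
  have := hn.isNonsep_pair.union_ear hadj hinj (by simp) (by simp) hpv h0
  convert this using 1
  rw [Set.insert_union, Set.singleton_union, Set.insert_eq_of_mem (a := p n)]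
  exact ⟨n, by simp, rfl⟩

theorem IsInducedPath.isNonsep_insert {p : ℕ → V} {n : ℕ} (h : G.IsInducedPath p n) {v : V}
    (hpv : ∀ i ≤ n, p i ≠ v) (h0 : G.Adj v (p 0)) (hn : G.Adj v (p n)) :
    G.IsNonsep (insert v (p '' Set.Iic n)) :=
  isNonsep_insert_walk (fun _ hk => h.adj_succ hk) h.injOn hpv h0 hn

theorem LinkedIn.exists_walk {R : Set V} {a b : V} (h : G.LinkedIn R a b) (ha : a ∈ R) :
    ∃ (n : ℕ) (p : ℕ → V), p 0 = a ∧ p n = b ∧ (∀ i ≤ n, p i ∈ R) ∧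
      ∀ i < n, G.Adj (p i) (p (i + 1)) := by
  induction h with
  | refl => exact ⟨0, fun _ => a, rfl, rfl, fun _ _ => ha, by simp⟩
  | @tail c d _ h ih =>
    obtain ⟨n, p, h0, hn, hR, hadj⟩ := ih
    refine ⟨n + 1, fun i => if i ≤ n then p i else d, by simpa using h0, by simp, ?_, ?_⟩
    · intro i _
      by_cases hi : i ≤ n
      · simpa [hi] using hR i hi
      · simpa [hi] using h.2.2
    · intro i hi
      by_cases h' : i = n
      · subst h'
        simpa [hn] using h.1
      · have : i ≤ n := by omega
        have : i + 1 ≤ n := by omega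
        simpa [*] using hadj i (by omega)

/-- A shortest walk is an induced path. -/
theorem LinkedIn.exists_inducedPath {R : Set V} {a b : V} (h : G.LinkedIn R a b) (ha : a ∈ R) :
    ∃ (n : ℕ) (p : ℕ → V), p 0 = a ∧ p n = b ∧ (∀ i ≤ n, p i ∈ R) ∧ G.IsInducedPath p n := by
  classical
  have hex := h.exists_walk ha
  obtain ⟨p, h0, hn, hR, hadj⟩ := Nat.find_spec hex
  have hmin := fun m => Nat.find_min hex (m := m)
  set n := Nat.find hex
  -- Jumping from `p i` to `p (i + l + 1)` would give a walk that is shorter by `l`.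
  have jump : ∀ i l, 0 < l → i + l + 1 ≤ n → ¬ G.Adj (p i) (p (i + l + 1)) := by
    intro i l hl hil had
    refine hmin (n - l) (by omega) ⟨fun k => if k ≤ i then p k else p (k + l), ?_, ?_, ?_, ?_⟩
    · simpa using h0
    · have : ¬ (n - l ≤ i) := by omega
      simp only [this, if_false]
      rw [Nat.sub_add_cancel (by omega), hn]
    · intro k hk
      by_cases hki : k ≤ i
      · simpa [hki] using hR k (by omega)
      · simpa [hki] using hR (k + l) (by omega)
    · intro k hk
      rcases lt_trichotomy k i with hki | rfl | hki
      · have h1 : k ≤ i := by omega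
        have h2 : k + 1 ≤ i := by omega
        simpa [h1, h2] using hadj k (by omega)
      · have h3 : k + 1 + l = k + l + 1 := by omega
        simpa [h3] using had
      · have h1 : ¬ k ≤ i := by omega
        have h2 : ¬ k + 1 ≤ i := by omega
        have h3 : k + 1 + l = k + l + 1 := by omega
        simpa [h1, h2, h3] using hadj (k + l) (by omega)
  have hne : ∀ i j, i < j → j ≤ n → p i ≠ p j := by
    intro i j hij hj he
    rcases hj.eq_or_lt with rfl | hj
    · refine hmin i hij ⟨p, h0, by rw [he, hn], fun k hk => hR k (by omega),
        fun k hk => hadj k (by omega)⟩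
    · have := hadj j hj
      rw [← he] at this
      exact jump i (j - i) (by omega) (by omega)
        (by rwa [show i + (j - i) + 1 = j + 1 by omega])
  have hadj2 : ∀ i j, i < j → j ≤ n → G.Adj (p i) (p j) → i + 1 = j := by
    intro i j hij hj had
    by_contra hne'
    exact jump i (j - i - 1) (by omega) (by omega)
      (by rwa [show i + (j - i - 1) + 1 = j by omega])
  refine ⟨n, p, h0, hn, hR, ⟨?_, ?_⟩⟩
  · intro i hi j hj he
    rcases lt_trichotomy i j with h | h | h
    · exact absurd he (hne i j h hj)
    · exact h
    · exact absurd he.symm (hne j i h hi)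
  · intro i j hi hj
    constructor
    · intro had
      rcases lt_trichotomy i j with h | rfl | h
      · exact Or.inl (hadj2 i j h hj had)
      · exact absurd rfl had.ne
      · exact Or.inr (hadj2 j i h hi had.symm)
    · rintro (rfl | rfl)
      · exact hadj i (by omega)
      · exact (hadj j (by omega)).symm

/-- `c 0, …, c (N - 1)` are distinct and induce a cycle of `G`, in this cyclic order. -/
structure IsInducedCycle (G : SimpleGraph V) (c : ℕ → V) (N : ℕ) : Prop where
  three_le : 3 ≤ N
  injOn : Set.InjOn c (Set.Iio N)
  adj_iff : ∀ i j, i < N → j < N →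
    (G.Adj (c i) (c j) ↔ i + 1 = j ∨ j + 1 = i ∨ i = 0 ∧ j + 1 = N ∨ j = 0 ∧ i + 1 = N)

theorem IsInducedPath.isInducedCycle {p : ℕ → V} {n : ℕ} (h : G.IsInducedPath p n) (hn : 1 ≤ n)
    {v : V} (hv : ∀ i ≤ n, p i ≠ v) (h0 : G.Adj v (p 0)) (hpn : G.Adj v (p n))
    (hch : ∀ i, 0 < i → i < n → ¬ G.Adj v (p i)) :
    G.IsInducedCycle (fun i => if i = 0 then v else p (i - 1)) (n + 2) where
  three_le := by omega
  injOn i hi j hj hij := by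
    simp only [Set.mem_Iio] at hi hj
    rcases Nat.eq_zero_or_pos i with rfl | hi0 <;> rcases Nat.eq_zero_or_pos j with rfl | hj0
    · rfl
    · simp only [if_true, hj0.ne', if_false] at hij
      exact absurd hij.symm (hv _ (by omega))
    · simp only [if_true, hi0.ne', if_false] at hij
      exact absurd hij (hv _ (by omega))
    · simp only [hi0.ne', hj0.ne', if_false] at hij
      have := h.injOn (x₁ := i - 1) (x₂ := j - 1) (by simp; omega) (by simp; omega) hij
      omega
  adj_iff := by
    have key : ∀ j, 0 < j → j < n + 2 → (G.Adj v (p (j - 1)) ↔ j = 1 ∨ j = n + 1) := by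
      intro j hj0 hj
      constructor
      · intro had
        by_contra hcon
        exact hch (j - 1) (by omega) (by omega) had
      · rintro (rfl | rfl)
        · exact h0
        · exact hpn
    intro i j hi hj
    rcases Nat.eq_zero_or_pos i with rfl | hi0 <;> rcases Nat.eq_zero_or_pos j with rfl | hj0
    · simp
    · simp only [if_true, hj0.ne', if_false]
      rw [key j hj0 hj]
      simp only [true_and, false_and, or_false]
      omega
    · simp only [if_true, hi0.ne', if_false]
      rw [G.adj_comm, key i hi0 hi]
      simp only [true_and, false_and, false_or]
      omega
    · simp only [hi0.ne', hj0.ne', if_false, false_and, or_false]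
      rw [h.adj_iff _ _ (by omega) (by omega)]
      omega

theorem image_cycle_eq {p : ℕ → V} {n : ℕ} {v : V} :
    (fun i => if i = 0 then v else p (i - 1)) '' Set.Iio (n + 2) = insert v (p '' Set.Iic n) := by
  ext x
  simp only [Set.mem_image, Set.mem_Iio, Set.mem_insert_iff, Set.mem_Iic]
  constructor
  · rintro ⟨i, hi, rfl⟩
    rcases Nat.eq_zero_or_pos i with rfl | hi0
    · simp
    · exact Or.inr ⟨i - 1, by omega, by simp [hi0.ne']⟩
  · rintro (rfl | ⟨i, hi, rfl⟩)
    · exact ⟨0, by omega, by simp⟩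
    · exact ⟨i + 1, by omega, by simp⟩

theorem IsInducedCycle.adj_mod {c : ℕ → V} {N : ℕ} (h : G.IsInducedCycle c N) (i : ℕ) :
    G.Adj (c (i % N)) (c ((i + 1) % N)) := by
  have hN := h.three_le
  have hlt : i % N < N := Nat.mod_lt _ (by omega)
  rw [h.adj_iff _ _ hlt (Nat.mod_lt _ (by omega)), ← Nat.mod_add_mod]
  by_cases hi : i % N + 1 = N
  · rw [hi, Nat.mod_self]
    omega
  · rw [Nat.mod_eq_of_lt (a := i % N + 1) (by omega)]
    exact Or.inl rfl

theorem IsInducedCycle.eq_or_eq {c : ℕ → V} {N : ℕ} (h : G.IsInducedCycle c N) {x y y' z : V}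
    (hx : x ∈ c '' Set.Iio N) (hy : y ∈ c '' Set.Iio N) (hy' : y' ∈ c '' Set.Iio N)
    (hz : z ∈ c '' Set.Iio N) (hxy : G.Adj x y) (hxy' : G.Adj x y') (hxz : G.Adj x z)
    (hne : y ≠ y') : z = y ∨ z = y' := by
  obtain ⟨i, hi, rfl⟩ := hx
  obtain ⟨j, hj, rfl⟩ := hy
  obtain ⟨k, hk, rfl⟩ := hy'
  obtain ⟨l, hl, rfl⟩ := hz
  simp only [Set.mem_Iio] at hi hj hk hl
  have hjk : j ≠ k := by rintro rfl; exact hne rfl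
  rw [h.adj_iff _ _ hi hj] at hxy
  rw [h.adj_iff _ _ hi hk] at hxy'
  rw [h.adj_iff _ _ hi hl] at hxz
  have : l = j ∨ l = k := by omega
  rcases this with rfl | rfl <;> simp

theorem IsInducedCycle.not_adj {c : ℕ → V} {N : ℕ} (h : G.IsInducedCycle c N) (hN : 4 ≤ N)
    {x y y' : V} (hx : x ∈ c '' Set.Iio N) (hy : y ∈ c '' Set.Iio N) (hy' : y' ∈ c '' Set.Iio N)
    (hxy : G.Adj x y) (hxy' : G.Adj x y') : ¬ G.Adj y y' := by
  obtain ⟨i, hi, rfl⟩ := hx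
  obtain ⟨j, hj, rfl⟩ := hy
  obtain ⟨k, hk, rfl⟩ := hy'
  simp only [Set.mem_Iio] at hi hj hk
  rw [h.adj_iff _ _ hi hj] at hxy
  rw [h.adj_iff _ _ hi hk] at hxy'
  rw [h.adj_iff _ _ hj hk]
  omega

end SimpleGraph

/-! ### Shift systems -/

/-- The combinatorics of moving the uncolored vertex in a tight coloring situation.

The type `V` holds the vertices and `K` the colors, `X v` being the colors that are available
at `v`.  Both digraphs are given by signed arcs: `E true v u` says that `vu` is an arc and
`E false v u` that `uv` is one, so that reversing an arc amounts to changing the sign;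
likewise `A` for the digraph on the colors.  `Good v φ` says that `φ` is an admissible coloring
of all vertices except for the *hole* `v`; the value `φ v` is irrelevant.  At the vertices `v` of `U` the
situation is tight: with the hole at `v`, each color of `v` has exactly `d s` neighbors of
sign `s` (`count`), each arc at `v` is covered by an arc between colors (`exists_label`), and
a neighbor `u` of `v` can hand over the hole (`shift`). -/
structure ShiftSystem (V K : Type*) where
  E : Bool → V → V → Prop
  A : Bool → K → K → Prop
  X : V → Set K
  d : Bool → ℕ
  U : Set V
  Good : V → (V → K) → Prop
  E_not : ∀ {s u v}, E s u v → E (!s) v u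
  E_irrefl : ∀ s v, ¬ E s v v
  A_not : ∀ {s x y}, A s x y → A (!s) y x
  arc_of : ∀ {s u v x y}, x ∈ X u → y ∈ X v → A s x y → E s u v
  inj : ∀ {s u v x x' y}, x ∈ X u → x' ∈ X u → y ∈ X v → A s x y → A s x' y → x = x'
  mem : ∀ {v φ u}, Good v φ → u ≠ v → φ u ∈ X u
  count : ∀ {v φ x}, Good v φ → v ∈ U → x ∈ X v → ∀ s, {u | u ≠ v ∧ A s x (φ u)}.ncard = d s
  exists_label : ∀ {v φ s u}, Good v φ → v ∈ U → E s v u → ∃ x ∈ X v, A s x (φ u)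
  shift : ∀ {v φ x s u ψ}, Good v φ → v ∈ U → x ∈ X v → u ≠ v → A s x (φ u) → ψ v = x →
    (∀ w, w ≠ v → w ≠ u → ψ w = φ w) → Good u ψ

namespace ShiftSystem

variable {V K : Type*} (F : ShiftSystem V K)

/-- The underlying graph. -/
def graph : SimpleGraph V where
  Adj u v := ∃ s, F.E s u v
  symm := ⟨fun _ _ ⟨s, h⟩ => ⟨!s, F.E_not h⟩⟩
  loopless := ⟨fun v ⟨s, h⟩ => F.E_irrefl s v h⟩

variable {F}

theorem E.adj {s : Bool} {u v : V} (h : F.E s u v) : F.graph.Adj u v := ⟨s, h⟩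

theorem A_of_not {s : Bool} {x y : K} (h : F.A (!s) x y) : F.A s y x := by
  simpa using F.A_not h

/-- The hole can be moved along any walk inside `U`; this recolors only vertices of the walk. -/
theorem exists_good_of_linkedIn {R : Set V} (hR : R ⊆ F.U) {v u : V} {φ : V → K}
    (h : F.graph.LinkedIn R v u) (hg : F.Good v φ) :
    ∃ ψ, F.Good u ψ ∧ Set.EqOn ψ φ Rᶜ := by
  classical
  induction h with
  | refl => exact ⟨φ, hg, fun _ _ => rfl⟩
  | @tail b c _ h ih =>
    obtain ⟨ψ, hψ, he⟩ := ih
    obtain ⟨⟨s, hs⟩, hb, hc⟩ := h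
    obtain ⟨x, hx, hxA⟩ := F.exists_label hψ (hR hb) hs
    have hne : c ≠ b := by rintro rfl; exact F.E_irrefl _ _ hs
    refine ⟨Function.update ψ b x, F.shift hψ (hR hb) hx hne hxA (by simp)
      (fun w hw _ => by simp [hw]), fun w hw => ?_⟩
    have : w ≠ b := by rintro rfl; exact hw hb
    simpa [this] using he hw

/-- The colors of the hole `v` with a neighbor of sign `s` among the colors chosen on `S`. -/
def signedLabels (F : ShiftSystem V K) (s : Bool) (S : Set V) (v : V) (φ : V → K) : Set K :=
  {x | x ∈ F.X v ∧ ∃ u ∈ S, u ≠ v ∧ F.A s x (φ u)}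

/-- The colors of the hole `v` with a neighbor (of any sign) among the colors chosen on `S`. -/
def labels (F : ShiftSystem V K) (S : Set V) (v : V) (φ : V → K) : Set K :=
  {x | ∃ s, x ∈ F.signedLabels s S v φ}

theorem signedLabels_subset {s : Bool} {S : Set V} {v : V} {φ : V → K} :
    F.signedLabels s S v φ ⊆ F.labels S v φ := fun _ h => ⟨s, h⟩

theorem signedLabels_mono {s : Bool} {S S' : Set V} (h : S ⊆ S') {v : V} {φ : V → K} :
    F.signedLabels s S v φ ⊆ F.signedLabels s S' v φ :=
  fun _ ⟨hx, u, hu, h'⟩ => ⟨hx, u, h hu, h'⟩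

theorem labels_mono {S S' : Set V} (h : S ⊆ S') {v : V} {φ : V → K} :
    F.labels S v φ ⊆ F.labels S' v φ := fun _ ⟨s, hx⟩ => ⟨s, signedLabels_mono h hx⟩

section Finite

variable [Finite V]

/-- A color of `v` has as many neighbors on `S` under `φ` as under `ψ`, for it has `d s` neighbors in
total, and the same ones outside of `S`. -/
theorem signedLabels_subset_of_eqOn {s : Bool} {S : Set V} {v : V} {φ ψ : V → K}
    (hvU : v ∈ F.U) (hφ : F.Good v φ) (hψ : F.Good v ψ) (he : Set.EqOn φ ψ Sᶜ) :
    F.signedLabels s S v φ ⊆ F.signedLabels s S v ψ := by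
  rintro x ⟨hx, u, huS, hu⟩
  refine ⟨hx, ?_⟩
  by_contra hcon
  push Not at hcon
  have h1 := F.count hφ hvU hx s
  have h2 := F.count hψ hvU hx s
  have : {u | u ≠ v ∧ F.A s x (ψ u)} ⊂ {u | u ≠ v ∧ F.A s x (φ u)} := by
    refine ⟨fun w ⟨hw, hwA⟩ => ⟨hw, ?_⟩, fun h => ?_⟩
    · by_cases hwS : w ∈ S
      · exact absurd hwA (hcon w hwS hw)
      · rwa [he hwS]
    · exact hcon u huS hu.1 (h hu).2
  have := Set.ncard_lt_ncard this
  omega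

theorem signedLabels_eq {s : Bool} {S : Set V} {v : V} {φ ψ : V → K}
    (hvU : v ∈ F.U) (hφ : F.Good v φ) (hψ : F.Good v ψ) (he : Set.EqOn φ ψ Sᶜ) :
    F.signedLabels s S v φ = F.signedLabels s S v ψ :=
  (signedLabels_subset_of_eqOn hvU hφ hψ he).antisymm
    (signedLabels_subset_of_eqOn hvU hψ hφ he.symm)

theorem labels_eq {S : Set V} {v : V} {φ ψ : V → K}
    (hvU : v ∈ F.U) (hφ : F.Good v φ) (hψ : F.Good v ψ) (he : Set.EqOn φ ψ Sᶜ) :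
    F.labels S v φ = F.labels S v ψ := by
  unfold labels
  simp only [signedLabels_eq hvU hφ hψ he]

/-- For an arc `vu` of a nonseparable set `S`, each label `x` at `v` is joined to a label at `u`: move
the hole out of `v` such that `v` gets the color `x`, and then to `u` within `S \ {v}`. -/
theorem exists_arc_signedLabels {S : Set V} (hS : F.graph.IsNonsep S) (hSU : S ⊆ F.U)
    {v u : V} (hv : v ∈ S) (hu : u ∈ S) {s : Bool} (hE : F.E s v u) {φ ψ : V → K}
    (hφ : F.Good v φ) (hψ : F.Good u ψ) (he : Set.EqOn φ ψ Sᶜ) {x : K}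
    (hx : x ∈ F.labels S v φ) : ∃ y ∈ F.signedLabels (!s) S u ψ, F.A s x y := by
  classical
  obtain ⟨s', hxv, t, htS, htv, hxt⟩ := hx
  have huv : v ≠ u := hE.adj.ne
  have hgt : F.Good t (Function.update φ v x) :=
    F.shift hφ (hSU hv) hxv htv hxt (by simp) (fun w hw _ => by simp [hw])
  obtain ⟨χ, hχ, heχ⟩ := exists_good_of_linkedIn (Set.sdiff_subset.trans hSU)
    (hS.linked_diff v t htS htv u hu huv.symm) hgt
  have hχv : χ v = x := by rw [heχ (by simp)]; simp
  obtain ⟨y, hy, hyA⟩ := F.exists_label hχ (hSU hu) (F.E_not hE)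
  rw [hχv] at hyA
  refine ⟨y, ?_, A_of_not hyA⟩
  have : y ∈ F.signedLabels (!s) S u χ := ⟨hy, v, hv, huv, by rwa [hχv]⟩
  rwa [signedLabels_eq (hSU hu) hχ hψ] at this
  intro w hw
  have hwv : w ≠ v := by rintro rfl; exact hw hv
  rw [heχ (fun h => hw h.1), ← he hw]
  simp [hwv]

variable [Finite K]

theorem ncard_labels_le_signedLabels {S : Set V} (hS : F.graph.IsNonsep S) (hSU : S ⊆ F.U)
    {v u : V} (hv : v ∈ S) (hu : u ∈ S) {s : Bool} (hE : F.E s v u) {φ ψ : V → K}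
    (hφ : F.Good v φ) (hψ : F.Good u ψ) (he : Set.EqOn φ ψ Sᶜ) :
    (F.labels S v φ).ncard ≤ (F.signedLabels (!s) S u ψ).ncard := by
  have h := fun x (hx : x ∈ F.labels S v φ) => exists_arc_signedLabels hS hSU hv hu hE hφ hψ he hx
  choose! f hf hfA using h
  refine Set.ncard_le_ncard_of_injOn f hf ?_ (Set.toFinite _)
  intro x hx x' hx' hxx
  have h2 := hfA x' hx'
  rw [← hxx] at h2
  obtain ⟨_, hxv, _⟩ := id hx
  obtain ⟨_, hxv', _⟩ := id hx'
  exact F.inj hxv hxv' (hf x hx).1 (hfA x hx) h2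

theorem ncard_labels_le {S : Set V} (hS : F.graph.IsNonsep S) (hSU : S ⊆ F.U)
    {v u : V} (hv : v ∈ S) (hu : u ∈ S) (hE : F.graph.Adj v u) {φ ψ : V → K}
    (hφ : F.Good v φ) (hψ : F.Good u ψ) (he : Set.EqOn φ ψ Sᶜ) :
    (F.labels S v φ).ncard ≤ (F.labels S u ψ).ncard := by
  obtain ⟨s, hs⟩ := hE
  exact (ncard_labels_le_signedLabels hS hSU hv hu hs hφ hψ he).trans
    (Set.ncard_le_ncard signedLabels_subset (Set.toFinite _))

/-- The number of labels does not depend on the position of the hole in a nonseparable set. -/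
theorem ncard_labels_eq {S : Set V} (hS : F.graph.IsNonsep S) (hSU : S ⊆ F.U)
    {v u : V} (hv : v ∈ S) (hu : u ∈ S) {φ ψ : V → K}
    (hφ : F.Good v φ) (hψ : F.Good u ψ) (he : Set.EqOn φ ψ Sᶜ) :
    (F.labels S v φ).ncard = (F.labels S u ψ).ncard := by
  have h := hS.linked v hv u hu
  clear hu
  induction h generalizing ψ with
  | refl => rw [labels_eq (hSU hv) hφ hψ he]
  | @tail b c _ h ih =>
    obtain ⟨hbc, hb, hc⟩ := h
    obtain ⟨χ, hχ, heχ⟩ := exists_good_of_linkedIn hSU (hbc.symm.linkedIn hc hb) hψ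
    rw [ih hχ (he.trans heχ.symm)]
    exact (ncard_labels_le hS hSU hb hc hbc hχ hψ heχ).antisymm
      (ncard_labels_le hS hSU hc hb hbc.symm hψ hχ heχ.symm)

/-- If an arc of sign `s` joins the hole to another vertex of `S`, then every label has a neighbor
of sign `s`, because the labels at `u` inject into the labels of sign `s` at `v`. -/
theorem signedLabels_eq_labels {S : Set V} (hS : F.graph.IsNonsep S) (hSU : S ⊆ F.U)
    {v u : V} (hv : v ∈ S) (hu : u ∈ S) {s : Bool} (hE : F.E s v u) {φ : V → K}
    (hφ : F.Good v φ) : F.signedLabels s S v φ = F.labels S v φ := by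
  obtain ⟨χ, hχ, heχ⟩ := exists_good_of_linkedIn hSU (hS.linked v hv u hu) hφ
  have h1 := ncard_labels_le_signedLabels hS hSU hu hv (F.E_not hE) hχ hφ heχ
  rw [Bool.not_not, ncard_labels_eq hS hSU hu hv hχ hφ heχ] at h1
  exact Set.eq_of_subset_of_ncard_le signedLabels_subset h1 (Set.toFinite _)

/-- For a digon the two colors at the hole that see `φ u` (one along each arc) agree. -/
theorem label_unique {v u : V} (hv : v ∈ F.U) (hu : u ∈ F.U) (hvu : u ≠ v) {φ : V → K}
    (hφ : F.Good v φ) {x x' : K} {s s' : Bool} (hx : x ∈ F.X v) (hx' : x' ∈ F.X v)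
    (h : F.A s x (φ u)) (h' : F.A s' x' (φ u)) : x = x' := by
  have hE : F.E s v u := F.arc_of hx (F.mem hφ hvu) h
  have := signedLabels_eq_labels (S := {v, u}) hE.adj.isNonsep_pair
    (Set.insert_subset hv (by simpa using hu)) (by simp) (by simp) hE hφ
  have hmem : x' ∈ F.labels {v, u} v φ := ⟨s', hx', u, by simp, hvu, h'⟩
  rw [← this] at hmem
  obtain ⟨_, t, ht, htv, hA⟩ := hmem
  obtain rfl : t = u := by simpa [htv] using ht
  exact F.inj hx hx' (F.mem hφ hvu) h hA

end Finite

open Classical in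
/-- A color of `v` that is adjacent to the color `y`, and `y` itself if there is none. -/
noncomputable def colorAt (F : ShiftSystem V K) (v : V) (y : K) : K :=
  if h : ∃ x ∈ F.X v, ∃ s, F.A s x y then h.choose else y

/-- The label of `u`: the color of the hole `v` that is adjacent to the color of `u`. It is unique
if `u` and `v` are adjacent vertices of `U` (`label_eq`). -/
noncomputable def label (F : ShiftSystem V K) (v : V) (φ : V → K) (u : V) : K :=
  F.colorAt v (φ u)

theorem label_congr {v u : V} {φ ψ : V → K} (h : φ u = ψ u) : F.label v φ u = F.label v ψ u := by
  unfold label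
  rw [h]

theorem label_spec {v u : V} (hv : v ∈ F.U) (h : F.graph.Adj v u) {φ : V → K} (hφ : F.Good v φ) :
    F.label v φ u ∈ F.X v ∧ ∃ s, F.A s (F.label v φ u) (φ u) := by
  obtain ⟨s, hs⟩ := h
  obtain ⟨x, hx, hxA⟩ := F.exists_label hφ hv hs
  have hex : ∃ x ∈ F.X v, ∃ s, F.A s x (φ u) := ⟨x, hx, s, hxA⟩
  unfold label colorAt
  rw [dif_pos hex]
  exact hex.choose_spec

variable [Finite V] [Finite K]

theorem label_eq {v u : V} (hv : v ∈ F.U) (hu : u ∈ F.U) (hvu : u ≠ v) {φ : V → K}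
    (hφ : F.Good v φ) {x : K} {s : Bool} (hx : x ∈ F.X v) (h : F.A s x (φ u)) :
    F.label v φ u = x := by
  have hE : F.E s v u := F.arc_of hx (F.mem hφ hvu) h
  obtain ⟨h1, s', h2⟩ := label_spec hv hE.adj hφ
  exact label_unique hv hu hvu hφ h1 hx h2 h

theorem arc_label {v u : V} (hv : v ∈ F.U) (hu : u ∈ F.U) {φ : V → K}
    (hφ : F.Good v φ) {s : Bool} (h : F.E s v u) : F.A s (F.label v φ u) (φ u) := by
  obtain ⟨x, hx, hxA⟩ := F.exists_label hφ hv h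
  rwa [label_eq hv hu h.adj.ne' hφ hx hxA]

theorem mem_labels {S : Set V} (hSU : S ⊆ F.U) {v : V} (hv : v ∈ S) {φ : V → K}
    (hφ : F.Good v φ) {x : K} :
    x ∈ F.labels S v φ ↔ ∃ u ∈ S, F.graph.Adj v u ∧ F.label v φ u = x := by
  constructor
  · rintro ⟨s, hx, u, hu, huv, hA⟩
    exact ⟨u, hu, E.adj (F.arc_of hx (F.mem hφ huv) hA), label_eq (hSU hv) (hSU hu) huv hφ hx hA⟩
  · rintro ⟨u, hu, huv, rfl⟩
    obtain ⟨h1, s, h2⟩ := label_spec (hSU hv) huv hφ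
    exact ⟨s, h1, u, hu, huv.ne', h2⟩

theorem label_mem_labels {S : Set V} (hSU : S ⊆ F.U) {v u : V} (hv : v ∈ S) (hu : u ∈ S)
    {φ : V → K} (hφ : F.Good v φ) (h : F.graph.Adj v u) : F.label v φ u ∈ F.labels S v φ :=
  (mem_labels hSU hv hφ).2 ⟨u, hu, h, rfl⟩

theorem two_le_ncard_labels {S : Set V} (hSU : S ⊆ F.U) {v u w : V} (hv : v ∈ S) (hu : u ∈ S)
    (hw : w ∈ S) {φ : V → K} (hφ : F.Good v φ) (hvu : F.graph.Adj v u) (hvw : F.graph.Adj v w)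
    (hne : F.label v φ u ≠ F.label v φ w) : 2 ≤ (F.labels S v φ).ncard :=
  (Set.one_lt_ncard (Set.toFinite _)).2 ⟨_, label_mem_labels hSU hv hu hφ hvu, _,
    label_mem_labels hSU hv hw hφ hvw, hne⟩

theorem exists_labels_ne {S : Set V} (hSU : S ⊆ F.U) {v : V} (hv : v ∈ S) {φ : V → K}
    (hφ : F.Good v φ) (h : 2 ≤ (F.labels S v φ).ncard) :
    ∃ u ∈ S, ∃ w ∈ S, F.graph.Adj v u ∧ F.graph.Adj v w ∧ F.label v φ u ≠ F.label v φ w := by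
  obtain ⟨x, hx, y, hy, hxy⟩ := (Set.one_lt_ncard (Set.toFinite _)).1 h
  obtain ⟨u, hu, hvu, rfl⟩ := (mem_labels hSU hv hφ).1 hx
  obtain ⟨w, hw, hvw, rfl⟩ := (mem_labels hSU hv hφ).1 hy
  exact ⟨u, hu, w, hw, hvu, hvw, hxy⟩

/-- Moving the hole from `v` to `z`, inside `R` to `a`, and back to `v` carries the label of `z`
to `a` and recolors nothing outside of `R`. -/
theorem exists_rotation {R : Set V} (hR : R ⊆ F.U) {v z a : V} (hvU : v ∈ F.U) (hvR : v ∉ R)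
    (ha : a ∈ R) (hvz : F.graph.Adj v z) (hva : F.graph.Adj v a)
    (hza : F.graph.LinkedIn R z a) {φ : V → K} (hφ : F.Good v φ) :
    ∃ ψ, F.Good v ψ ∧ (∀ w ∉ R, w ≠ v → ψ w = φ w) ∧ F.label v ψ a = F.label v φ z := by
  classical
  obtain ⟨hx, s, hxA⟩ := label_spec hvU hvz hφ
  set x := F.label v φ z
  have hgz : F.Good z (Function.update φ v x) :=
    F.shift hφ hvU hx hvz.ne' hxA (by simp) (fun w hw _ => by simp [hw])
  obtain ⟨χ, hχ, heχ⟩ := exists_good_of_linkedIn hR hza hgz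
  have hχv : χ v = x := by rw [heχ hvR]; simp
  obtain ⟨hy, t, hyA⟩ := label_spec (hR ha) hva.symm hχ
  set y := F.label a χ v
  have hψ : F.Good v (Function.update χ a y) :=
    F.shift hχ (hR ha) hy hva.ne hyA (by simp) (fun w hw _ => by simp [hw])
  refine ⟨_, hψ, ?_, ?_⟩
  · intro w hw hwv
    have hwa : w ≠ a := by rintro rfl; exact hw ha
    simp [hwa, heχ hw, hwv]
  · refine label_eq hvU (hR ha) hva.ne' hψ hx (s := !t) ?_
    rw [hχv] at hyA
    simpa using F.A_not hyA

/-- The exclusion of theta-like configurations.  The set `S` consists of a smaller nonseparable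
set `C`, in which `v` has just the neighbors `a` and `b`, and of further vertices, among them
a third neighbor `z` of `v` that can be joined to `a` without using `v` and `b`.  Moreover, some vertex `q`
of `C` has no neighbors in `S` outside of `C`, so that `S` and `C` have the same number of labels,
as is seen with the hole at `q`. -/
theorem false_of_theta {S C : Set V} (hS : F.graph.IsNonsep S) (hC : F.graph.IsNonsep C)
    (hSU : S ⊆ F.U) (hCS : C ⊆ S) {q v a b z : V} (hq : q ∈ C)
    (hqN : ∀ w ∈ S, F.graph.Adj q w → w ∈ C) (hv : v ∈ C) (ha : a ∈ C) (hb : b ∈ C) (hab : a ≠ b)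
    (hva : F.graph.Adj v a) (hvb : F.graph.Adj v b)
    (hvN : ∀ w ∈ C, F.graph.Adj v w → w = a ∨ w = b) (hz : z ∈ S) (hzC : z ∉ C)
    (hvz : F.graph.Adj v z) (hza : F.graph.LinkedIn (S \ {v, b}) z a) {φ : V → K}
    (hφ : F.Good v φ) (h2 : 2 ≤ (F.labels S v φ).ncard) : False := by
  have hCU := hCS.trans hSU
  have hvS := hCS hv
  -- The labels of `a` and `b` are different in every position, and no further label occurs.
  have key : ∀ ψ, F.Good v ψ → Set.EqOn φ ψ Sᶜ → F.label v ψ a ≠ F.label v ψ b ∧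
      (F.label v ψ z = F.label v ψ a ∨ F.label v ψ z = F.label v ψ b) := by
    intro ψ hψ he
    obtain ⟨χ, hχ, heχ⟩ := exists_good_of_linkedIn hCU (hC.linked v hv q hq) hψ
    have heS : Set.EqOn ψ χ Sᶜ := fun w hw => (heχ fun h => hw (hCS h)).symm
    have hqlab : F.labels S q χ = F.labels C q χ := by
      refine Set.Subset.antisymm ?_ (labels_mono hCS)
      intro x hx
      obtain ⟨w, hw, hqw, rfl⟩ := (mem_labels hSU (hCS hq) hχ).1 hx
      exact label_mem_labels hCU hq (hqN w hw hqw) hχ hqw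
    have e1 := ncard_labels_eq hC hCU hv hq hψ hχ heχ.symm
    have e2 := ncard_labels_eq hS hSU hvS (hCS hq) hψ hχ heS
    have e3 : F.labels S v φ = F.labels S v ψ := labels_eq (hSU hvS) hφ hψ he
    have e4 : F.labels C v ψ = F.labels S v ψ :=
      Set.eq_of_subset_of_ncard_le (labels_mono hCS) (by rw [e1, e2, hqlab]) (Set.toFinite _)
    refine ⟨fun hne => ?_, ?_⟩
    · obtain ⟨u, hu, w, hw, hvu, hvw, hn⟩ := exists_labels_ne hCU hv hψ (by rwa [e4, ← e3])
      rcases hvN u hu hvu with rfl | rfl <;> rcases hvN w hw hvw with rfl | rfl <;> simp_all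
    · have := label_mem_labels hSU hvS hz hψ hvz
      rw [← e4] at this
      obtain ⟨w, hw, hvw, hwz⟩ := (mem_labels hCU hv hψ).1 this
      rcases hvN w hw hvw with rfl | rfl
      · exact Or.inl hwz.symm
      · exact Or.inr hwz.symm
  -- Carrying the label of `z` to `a` shows that it differs from the label of `b`, …
  have hzb : ∀ ψ, F.Good v ψ → Set.EqOn φ ψ Sᶜ → F.label v ψ z ≠ F.label v ψ b := by
    intro ψ hψ he
    obtain ⟨χ, hχ, heχ, hl⟩ := exists_rotation (R := S \ {v, b}) (Set.sdiff_subset.trans hSU)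
      (hSU hvS) (by simp) ⟨hCS ha, by simp [hva.ne', hab]⟩ hvz hva hza hψ
    have h := (key χ hχ fun w hw => by
      rw [heχ w (fun h => hw h.1) (by rintro rfl; exact hw hvS), he hw]).1
    rwa [hl, label_congr (heχ b (by simp) hvb.ne')] at h
  -- … so `z` and `a` have the same label, which the label of `b` becomes, too, when the label of
  -- `a` is carried to `b` along `C`.
  have hza' := (key φ hφ fun _ _ => rfl).2.resolve_right (hzb φ hφ fun _ _ => rfl)
  obtain ⟨ψ, hψ, heψ, hl⟩ := exists_rotation (R := C \ {v}) (Set.sdiff_subset.trans hCU)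
    (hSU hvS) (by simp) ⟨hb, hvb.ne'⟩ hva hvb
    (hC.linked_diff v a ha hva.ne' b hb hvb.ne') hφ
  refine hzb ψ hψ (fun w hw =>
    (heψ w (fun h => hw (hCS h.1)) (by rintro rfl; exact hw hvS)).symm) ?_
  rw [hl, ← hza', label_congr (heψ z (fun h => hzC h.1) hvz.ne')]

/-- With more than one label there is no induced `K₄` minus an edge: this is a theta graph. -/
theorem false_of_diamond {a b c d h : V} (hU : {a, b, c, d} ⊆ F.U) (hab : F.graph.Adj a b)
    (hac : F.graph.Adj a c) (had : F.graph.Adj a d) (hbc : F.graph.Adj b c)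
    (hbd : F.graph.Adj b d) (hcd : ¬ F.graph.Adj c d) (hne : c ≠ d)
    (hh : h ∈ ({a, b, c, d} : Set V)) {φ : V → K} (hφ : F.Good h φ)
    (h2 : 2 ≤ (F.labels {a, b, c, d} h φ).ncard) : False := by
  have hC : F.graph.IsNonsep {c, a, b} :=
    hab.isNonsep_pair.insert (by simp) (by simp) hab.ne hac.symm hbc.symm
  have hS : F.graph.IsNonsep {a, b, c, d} := by
    have := hC.insert (z := d) (v := a) (w := b) (by simp) (by simp) hab.ne had.symm hbd.symm
    convert this using 1
    ext x
    simp only [Set.mem_insert_iff, Set.mem_singleton_iff]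
    tauto
  obtain ⟨χ, hχ, heχ⟩ := exists_good_of_linkedIn hU (hS.linked h hh a (by simp)) hφ
  rw [ncard_labels_eq hS hU hh (by simp) hφ hχ heχ.symm] at h2
  refine false_of_theta hS hC hU (by rintro x (rfl | rfl | rfl) <;> simp) (q := c) (v := a)
    (a := b) (b := c) (z := d) (by simp) ?_ (by simp) (by simp) (by simp) hbc.ne hab hac ?_
    (by simp) ?_ had ?_ hχ h2
  · rintro w (rfl | rfl | rfl | rfl) hw
    · simp
    · simp
    · simp
    · exact absurd hw hcd
  · rintro w (rfl | rfl | rfl) hw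
    · exact Or.inr rfl
    · exact absurd rfl hw.ne
    · exact Or.inl rfl
  · simp [hne.symm, had.ne', hbd.ne']
  · exact hbd.symm.linkedIn (by simp [had.ne', hne.symm]) (by simp [hab.ne', hbc.ne])

end ShiftSystem

/-! ### Blocks with more than one label are cycles or complete -/

namespace ShiftSystem

variable {V K : Type*} {F : ShiftSystem V K} [Finite V] [Finite K]

/-- The case of `false_of_theta` where `C` consists of `v` and the part of an induced path from `r 0`
up to the next neighbor `r i` of `v`, and `r 0` has degree two in `S`. -/
theorem false_of_first_return {S : Set V} (hS : F.graph.IsNonsep S) (hSU : S ⊆ F.U) {r : ℕ → V}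
    {m i : ℕ} (hr : F.graph.IsInducedPath r m) (him : i ≤ m) (hi : 1 ≤ i)
    (hrS : ∀ k ≤ i, r k ∈ S) {v z : V} (hv : v ∈ S) (hrv : ∀ k ≤ i, r k ≠ v)
    (h0 : F.graph.Adj v (r 0)) (hvi : F.graph.Adj v (r i))
    (hmin : ∀ k, 1 ≤ k → k < i → ¬ F.graph.Adj v (r k))
    (hN : ∀ w ∈ S, F.graph.Adj (r 0) w → w = v ∨ w = r 1)
    (hz : z ∈ S) (hvz : F.graph.Adj v z) (hzr : ∀ k ≤ i, z ≠ r k)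
    (hzi : F.graph.LinkedIn (S \ {v, r 0}) z (r i)) {φ : V → K} (hφ : F.Good v φ)
    (h2 : 2 ≤ (F.labels S v φ).ncard) : False := by
  have hC : F.graph.IsNonsep (insert v (r '' Set.Iic i)) :=
    SimpleGraph.isNonsep_insert_walk (fun k hk => hr.adj_succ (by omega))
      (hr.injOn.mono (Set.Iic_subset_Iic.2 him)) hrv h0 hvi
  refine false_of_theta hS hC hSU ?_ (q := r 0) (v := v) (a := r i) (b := r 0) (z := z)
    (Or.inr ⟨0, by simp, rfl⟩) ?_ (Or.inl rfl) (Or.inr ⟨i, by simp, rfl⟩)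
    (Or.inr ⟨0, by simp, rfl⟩) (hr.ne him (by omega) (by omega)) hvi h0 ?_ hz ?_ hvz hzi hφ h2
  · rintro x (rfl | ⟨k, hk, rfl⟩)
    · exact hv
    · exact hrS k hk
  · intro w hw hadj
    rcases hN w hw hadj with rfl | rfl
    · exact Or.inl rfl
    · exact Or.inr ⟨1, hi, rfl⟩
  · rintro w (rfl | ⟨k, hk, rfl⟩) hadj
    · exact absurd rfl hadj.ne
    · simp only [Set.mem_Iic] at hk
      rcases Nat.eq_zero_or_pos k with rfl | hk0
      · exact Or.inr rfl
      · rcases hk.eq_or_lt with rfl | hlt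
        · exact Or.inl rfl
        · exact absurd hadj (hmin k hk0 hlt)
  · rintro (rfl | ⟨k, hk, rfl⟩)
    · exact absurd rfl hvz.ne
    · exact hzr k hk rfl

omit [Finite V] [Finite K] in
/-- The first neighbor of `v` on `r` after `r 0`. -/
theorem exists_first_return {G : SimpleGraph V} {r : ℕ → V} {v : V} {j : ℕ} (hj : 1 ≤ j)
    (h : G.Adj v (r j)) :
    ∃ i, 1 ≤ i ∧ i ≤ j ∧ G.Adj v (r i) ∧ ∀ k, 1 ≤ k → k < i → ¬ G.Adj v (r k) := by
  classical
  have hex : ∃ i, 1 ≤ i ∧ G.Adj v (r i) := ⟨j, hj, h⟩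
  exact ⟨Nat.find hex, (Nat.find_spec hex).1, Nat.find_min' hex ⟨hj, h⟩, (Nat.find_spec hex).2,
    fun k hk hki had => Nat.find_min hex hki ⟨hk, had⟩⟩

/-! In the following statements `p` is an induced path in `W` that avoids the hole `v` and joins two
neighbors of `v` with different labels. -/

section ClosedPath

variable {W : Set V} (hWU : W ⊆ F.U) {v : V} (hv : v ∈ W) {p : ℕ → V} {n : ℕ}
  (hp : F.graph.IsInducedPath p n) (hpW : ∀ i ≤ n, p i ∈ W \ {v}) (h0 : F.graph.Adj v (p 0))
  (hn : F.graph.Adj v (p n)) {φ : V → K} (hφ : F.Good v φ)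
  (hl : F.label v φ (p 0) ≠ F.label v φ (p n))

include hWU hv hp hpW h0 hn hφ hl

/-- The vertex `v` has no neighbors in the interior of `p`. -/
theorem not_adj_of_label_ne (i : ℕ) (hi0 : 0 < i) (hin : i < n) : ¬ F.graph.Adj v (p i) := by
  intro had
  obtain ⟨j, hj1, hji, hj, hmin⟩ := exists_first_return hi0 had
  have hSW : insert v (p '' Set.Iic n) ⊆ W := by
    rintro x (rfl | ⟨k, hk, rfl⟩)
    · exact hv
    · exact (hpW k hk).1
  have hmem : ∀ k ≤ n, p k ∈ insert v (p '' Set.Iic n) := fun k hk => Or.inr ⟨k, hk, rfl⟩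
  refine false_of_first_return (S := insert v (p '' Set.Iic n))
    (hp.isNonsep_insert (fun k hk => (hpW k hk).2) h0 hn) (hSW.trans hWU) hp (i := j) (z := p n) (by omega) hj1
    (fun k hk => hmem k (by omega)) (Or.inl rfl) (fun k hk => (hpW k (by omega)).2) h0 hj hmin ?_
    (hmem n le_rfl) hn (fun k hk => hp.ne le_rfl (by omega) (by omega)) ?_ hφ
    (two_le_ncard_labels (hSW.trans hWU) (Or.inl rfl) (hmem 0 (by omega)) (hmem n le_rfl) hφ
      h0 hn hl)
  · rintro w (rfl | ⟨k, hk, rfl⟩) hadj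
    · exact Or.inl rfl
    · rw [hp.adj_iff _ _ (by omega) hk] at hadj
      obtain rfl : k = 1 := by omega
      exact Or.inr rfl
  · refine SimpleGraph.LinkedIn.symm (SimpleGraph.linkedIn_of_walk (p := p) (i := j) (j := n) (by omega)
      (fun k _ hk => hp.adj_succ hk) fun k hjk hk => ⟨hmem k hk, ?_⟩)
    rintro (h | h)
    · exact (hpW k hk).2 h
    · exact hp.ne hk (by omega) (by omega) h

/-- A third neighbor `z` of `v` has a neighbor on `p`.  Otherwise `z` has degree two in the
union of the cycle formed by `v` and `p` with an induced path from `z` to `p 0`. -/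
theorem adj_of_third_neighbor (hW : F.graph.IsNonsep W) {z : V} (hz : z ∈ W)
    (hvz : F.graph.Adj v z) (hz0 : z ≠ p 0) (hzn : z ≠ p n) : ∃ j ≤ n, F.graph.Adj z (p j) := by
  by_contra hcon
  push Not at hcon
  have hch := not_adj_of_label_ne hWU hv hp hpW h0 hn hφ hl
  have hzp : ∀ k ≤ n, z ≠ p k := by
    rintro k hk rfl
    have : k ≠ 0 := by rintro rfl; exact hz0 rfl
    have : k ≠ n := by rintro rfl; exact hzn rfl
    exact hch k (by omega) (by omega) hvz
  obtain ⟨m, r, hr0, hrm, hrW, hr⟩ := (hW.linked_diff v z hz hvz.ne' (p 0) (hpW 0 (by omega)).1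
    h0.ne').exists_inducedPath ⟨hz, hvz.ne'⟩
  have hm : 1 ≤ m := by
    by_contra hm
    obtain rfl : m = 0 := by omega
    exact hz0 (hr0.symm.trans hrm)
  obtain ⟨i, hi1, him, hi, hmin⟩ := exists_first_return hm (by rwa [hrm] : F.graph.Adj v (r m))
  set S := insert v (p '' Set.Iic n) ∪ r '' Set.Iic m with hSdef
  have hpS : ∀ k ≤ n, p k ∈ S := fun k hk => Or.inl (Or.inr ⟨k, hk, rfl⟩)
  have hrS : ∀ k ≤ m, r k ∈ S := fun k hk => Or.inr ⟨k, hk, rfl⟩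
  have hvS : v ∈ S := Or.inl (Or.inl rfl)
  have hSU : S ⊆ F.U := by
    rintro x ((rfl | ⟨k, hk, rfl⟩) | ⟨k, hk, rfl⟩)
    · exact hWU hv
    · exact hWU (hpW k hk).1
    · exact hWU (hrW k hk).1
  have hS : F.graph.IsNonsep S :=
    (hp.isNonsep_insert (fun k hk => (hpW k hk).2) h0 hn).union_ear (p := r) (fun k hk => hr.adj_succ hk) hr.injOn
      (Or.inr ⟨0, by simp, hrm.symm⟩) (Or.inl rfl) (fun k hk => (hrW k hk).2) (by rwa [hr0])
  have h2 := two_le_ncard_labels hSU hvS (hpS 0 (by omega)) (hpS n le_rfl) hφ h0 hn hl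
  have hN : ∀ w ∈ S, F.graph.Adj (r 0) w → w = v ∨ w = r 1 := by
    rintro w ((rfl | ⟨k, hk, rfl⟩) | ⟨k, hk, rfl⟩) hadj
    · exact Or.inl rfl
    · rw [hr0] at hadj
      exact absurd hadj (hcon k hk)
    · rw [hr.adj_iff _ _ (by omega) hk] at hadj
      obtain rfl : k = 1 := by omega
      exact Or.inr rfl
  -- One of the two ends of the path `p` is a third neighbor of `v` in `S`.
  obtain ⟨t, ht, hti⟩ : ∃ t, (t = 0 ∨ t = n) ∧ p t ≠ r i := by
    by_cases h : p 0 = r i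
    · refine ⟨n, Or.inr rfl, fun h' => hl ?_⟩
      rw [h, h']
    · exact ⟨0, Or.inl rfl, h⟩
  have htn : t ≤ n := by omega
  have hvt : F.graph.Adj v (p t) := by rcases ht with rfl | rfl <;> assumption
  refine false_of_first_return hS hSU hr (i := i) (z := p t) him hi1
    (fun k hk => hrS k (by omega)) hvS (fun k hk => (hrW k (by omega)).2) (by rwa [hr0]) hi hmin hN
    (hpS t htn) hvt ?_ ?_ hφ h2
  · rintro k hk he
    rcases Nat.eq_zero_or_pos k with rfl | hk0
    · rw [hr0] at he
      exact hzp t htn he.symm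
    · rcases hk.eq_or_lt with rfl | hlt
      · exact hti he
      · exact hmin k hk0 hlt (he ▸ hvt)
  · refine SimpleGraph.LinkedIn.trans (b := p 0) ?_ ?_
    · refine SimpleGraph.LinkedIn.symm (SimpleGraph.linkedIn_of_walk (p := p) (i := 0) (j := t) (by omega)
        (fun k _ hk => hp.adj_succ (by omega)) fun k _ hk => ⟨hpS k (by omega), ?_⟩)
      rintro (h | h)
      · exact (hpW k (by omega)).2 h
      · rw [Set.mem_singleton_iff, hr0] at h
        exact hzp k (by omega) h.symm
    · rw [← hrm]
      refine SimpleGraph.LinkedIn.symm (SimpleGraph.linkedIn_of_walk (p := r) (i := i) (j := m) (by omega)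
        (fun k _ hk => hr.adj_succ hk) fun k hjk hk => ⟨hrS k (by omega), ?_⟩)
      rintro (h | h)
      · exact (hrW k (by omega)).2 h
      · exact hr.ne hk (by omega) (by omega) h

/-- A third neighbor `z` of `v` is adjacent to all of `p`, for another vertex of `p` has its
neighbors on the cycle formed by `v` and `p` only. -/
theorem forall_adj_of_third_neighbor (hW : F.graph.IsNonsep W) {z : V} (hz : z ∈ W)
    (hvz : F.graph.Adj v z) (hz0 : z ≠ p 0) (hzn : z ≠ p n) (i : ℕ) (hi : i ≤ n) :
    F.graph.Adj z (p i) := by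
  by_contra hcon
  have hch := not_adj_of_label_ne hWU hv hp hpW h0 hn hφ hl
  obtain ⟨j, hj, hzj⟩ := adj_of_third_neighbor hWU hv hp hpW h0 hn hφ hl hW hz hvz hz0 hzn
  have hC := hp.isNonsep_insert (fun k hk => (hpW k hk).2) h0 hn
  have hpC : ∀ k ≤ n, p k ∈ insert v (p '' Set.Iic n) := fun k hk => Or.inr ⟨k, hk, rfl⟩
  have hS := hC.insert (Or.inl rfl) (hpC j hj) (Ne.symm (hpW j hj).2) hvz.symm hzj
  have hSU : insert z (insert v (p '' Set.Iic n)) ⊆ F.U := by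
    rintro x (rfl | rfl | ⟨k, hk, rfl⟩)
    · exact hWU hz
    · exact hWU hv
    · exact hWU (hpW k hk).1
  have hzC : z ∉ insert v (p '' Set.Iic n) := by
    rintro (rfl | ⟨k, hk, rfl⟩)
    · exact absurd rfl hvz.ne
    · simp only [Set.mem_Iic] at hk
      have : k ≠ 0 := by rintro rfl; exact hz0 rfl
      have : k ≠ n := by rintro rfl; exact hzn rfl
      exact hch k (by omega) (by omega) hvz
  have hn0 : p 0 ≠ p n := fun h => hl (by rw [h])
  have h2 := two_le_ncard_labels hSU (Or.inr (Or.inl rfl)) (Or.inr (hpC 0 (by omega)))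
    (Or.inr (hpC n le_rfl)) hφ h0 hn hl
  have hN : ∀ w ∈ insert z (insert v (p '' Set.Iic n)), F.graph.Adj (p i) w →
      w ∈ insert v (p '' Set.Iic n) := by
    rintro w (rfl | hw) hadj
    · exact absurd hadj.symm hcon
    · exact hw
  have hvN : ∀ w ∈ insert v (p '' Set.Iic n), F.graph.Adj v w → w = p 0 ∨ w = p n := by
    rintro w (rfl | ⟨k, hk, rfl⟩) hadj
    · exact absurd rfl hadj.ne
    · simp only [Set.mem_Iic] at hk
      by_contra hne
      push Not at hne
      have : k ≠ 0 := by rintro rfl; exact hne.1 rfl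
      have : k ≠ n := by rintro rfl; exact hne.2 rfl
      exact hch k (by omega) (by omega) hadj
  rcases hj.eq_or_lt with rfl | hjn
  · refine false_of_theta hS hC hSU (Set.subset_insert _ _) (hpC i hi) hN (Or.inl rfl)
      (hpC j le_rfl) (hpC 0 (by omega)) hn0.symm hn h0 (fun w hw h => (hvN w hw h).symm)
      (Or.inl rfl) hzC hvz ?_ hφ h2
    exact hzj.linkedIn ⟨Or.inl rfl, by simp [hvz.ne', hz0]⟩
      ⟨Or.inr (hpC j le_rfl), by simp [hn.ne', hn0.symm]⟩
  · refine false_of_theta hS hC hSU (Set.subset_insert _ _) (hpC i hi) hN (Or.inl rfl)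
      (hpC 0 (by omega)) (hpC n le_rfl) hn0 h0 hn hvN (Or.inl rfl) hzC hvz ?_ hφ h2
    have hmem : ∀ k ≤ j, p k ∈ insert z (insert v (p '' Set.Iic n)) \ {v, p n} := by
      intro k hk
      refine ⟨Or.inr (hpC k (by omega)), ?_⟩
      rintro (h | h)
      · exact (hpW k (by omega)).2 h
      · exact hp.ne (by omega) le_rfl (by omega) h
    refine SimpleGraph.LinkedIn.trans
      (hzj.linkedIn ⟨Or.inl rfl, by simp [hvz.ne', hzn]⟩ (hmem j le_rfl)) ?_
    exact SimpleGraph.LinkedIn.symm (SimpleGraph.linkedIn_of_walk (p := p) (Nat.zero_le j)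
      (fun k _ hk => hp.adj_succ (by omega)) fun k _ hk => hmem k hk)

/-- If `p` has at least three vertices, then `v` has no third neighbor `z`: the label of `z` would
differ from that of an end of `p`, and this end, its neighbor on `p`, `v` and `z` would induce `K₄`
minus an edge. -/
theorem eq_or_eq_of_adj_of_two_le (h2n : 2 ≤ n) (hW : F.graph.IsNonsep W) {z : V} (hz : z ∈ W)
    (hvz : F.graph.Adj v z) : z = p 0 ∨ z = p n := by
  by_contra hcon
  push Not at hcon
  have hch := not_adj_of_label_ne hWU hv hp hpW h0 hn hφ hl
  have hall := forall_adj_of_third_neighbor hWU hv hp hpW h0 hn hφ hl hW hz hvz hcon.1 hcon.2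
  have diamond : ∀ i j, i ≤ n → j ≤ n → F.graph.Adj v (p i) → F.graph.Adj (p i) (p j) →
      ¬ F.graph.Adj v (p j) → F.label v φ z ≠ F.label v φ (p i) → False := by
    intro i j hi hj hvi hij hvj hne
    have hU : ({z, p i, v, p j} : Set V) ⊆ F.U := by
      rintro x (rfl | rfl | rfl | rfl)
      · exact hWU hz
      · exact hWU (hpW i hi).1
      · exact hWU hv
      · exact hWU (hpW j hj).1
    exact false_of_diamond hU (hall i hi) hvz.symm (hall j hj) hvi.symm hij hvj (Ne.symm (hpW j hj).2)
      (h := v) (by simp) hφ (two_le_ncard_labels hU (by simp) (by simp) (by simp) hφ hvz hvi hne)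
  by_cases hz0 : F.label v φ z = F.label v φ (p 0)
  · refine diamond n (n - 1) le_rfl (by omega) hn ?_ (hch _ (by omega) (by omega)) (hz0 ▸ hl)
    exact (hp.adj_iff _ _ le_rfl (by omega)).2 (by omega)
  · exact diamond 0 1 (by omega) (by omega) h0 (hp.adj_succ (by omega))
      (hch _ (by omega) (by omega)) hz0

end ClosedPath

omit [Finite V] [Finite K] in
theorem exists_inducedPath_of_label_ne {W : Set V} (hW : F.graph.IsNonsep W) {v u w : V}
    (hu : u ∈ W) (hw : w ∈ W) (hvu : F.graph.Adj v u) (hvw : F.graph.Adj v w)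
    (huw : ¬ F.graph.Adj u w) {φ : V → K} (hl : F.label v φ u ≠ F.label v φ w) :
    ∃ (n : ℕ) (p : ℕ → V), 2 ≤ n ∧ p 0 = u ∧ p n = w ∧ (∀ i ≤ n, p i ∈ W \ {v}) ∧
      F.graph.IsInducedPath p n := by
  obtain ⟨n, p, h0, hn, hpW, hp⟩ :=
    (hW.linked_diff v u hu hvu.ne' w hw hvw.ne').exists_inducedPath ⟨hu, hvu.ne'⟩
  refine ⟨n, p, ?_, h0, hn, hpW, hp⟩
  by_contra hlt
  obtain rfl | rfl : n = 0 ∨ n = 1 := by omega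
  · rw [← h0, ← hn] at hl
    exact hl rfl
  · rw [← h0, ← hn] at huw
    exact huw (hp.adj_succ (by omega))

theorem eq_or_eq_of_adj {W : Set V} (hW : F.graph.IsNonsep W) (hWU : W ⊆ F.U) {v u w z : V}
    (hv : v ∈ W) (hu : u ∈ W) (hw : w ∈ W) (hz : z ∈ W) (hvu : F.graph.Adj v u)
    (hvw : F.graph.Adj v w) (hvz : F.graph.Adj v z) (huw : ¬ F.graph.Adj u w) {φ : V → K}
    (hφ : F.Good v φ) (hl : F.label v φ u ≠ F.label v φ w) : z = u ∨ z = w := by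
  obtain ⟨n, p, h2n, rfl, rfl, hpW, hp⟩ := exists_inducedPath_of_label_ne hW hu hw hvu hvw huw hl
  exact eq_or_eq_of_adj_of_two_le hWU hv hp hpW hvu hvw hφ hl h2n hW hz hvz

/-- Two nonadjacent neighbors of the hole with different labels force `W` to be an induced cycle.  A
vertex of the cycle with a neighbor outside of it would have two nonadjacent neighbors with
different labels, too, once the hole has been moved there. -/
theorem exists_isInducedCycle {W : Set V} (hW : F.graph.IsNonsep W) (hWU : W ⊆ F.U) {v u w : V}
    (hv : v ∈ W) (hu : u ∈ W) (hw : w ∈ W) (hvu : F.graph.Adj v u)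
    (hvw : F.graph.Adj v w) (huw : ¬ F.graph.Adj u w) {φ : V → K}
    (hφ : F.Good v φ) (hl : F.label v φ u ≠ F.label v φ w) :
    ∃ N c, F.graph.IsInducedCycle c N ∧ W = c '' Set.Iio N := by
  obtain ⟨n, p, h2n, rfl, rfl, hpW, hp⟩ := exists_inducedPath_of_label_ne hW hu hw hvu hvw huw hl
  have hch := not_adj_of_label_ne hWU hv hp hpW hvu hvw hφ hl
  have hpv : ∀ i ≤ n, p i ≠ v := fun i hi => (hpW i hi).2
  have hcyc := hp.isInducedCycle (by omega) hpv hvu hvw hch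
  have hC := hp.isNonsep_insert hpv hvu hvw
  rw [← SimpleGraph.image_cycle_eq] at hC
  set c : ℕ → V := fun i => if i = 0 then v else p (i - 1) with hc
  have hvC : v ∈ c '' Set.Iio (n + 2) := ⟨0, by simp, by simp [c]⟩
  have hpC : ∀ i ≤ n, p i ∈ c '' Set.Iio (n + 2) := fun i hi =>
    ⟨i + 1, by simp; omega, by simp [c]⟩
  have hCW : c '' Set.Iio (n + 2) ⊆ W := by
    rw [SimpleGraph.image_cycle_eq]
    rintro x (rfl | ⟨k, hk, rfl⟩)
    · exact hv
    · exact (hpW k hk).1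
  refine ⟨n + 2, c, hcyc, Set.Subset.antisymm ?_ hCW⟩
  intro x hx
  by_contra hxC
  obtain ⟨y, hy, z, hz, hyz, hyC, hzC⟩ :=
    (hW.linked v hv x hx).exists_adj_of_not (p := (· ∈ c '' Set.Iio (n + 2))) hvC hxC
  have hCU := hCW.trans hWU
  obtain ⟨χ, hχ, heχ⟩ := exists_good_of_linkedIn hCU (hC.linked v hvC y hyC) hφ
  have h2 := two_le_ncard_labels hCU hvC (hpC 0 (by omega)) (hpC n le_rfl) hφ hvu hvw hl
  rw [ncard_labels_eq hC hCU hvC hyC hφ hχ heχ.symm] at h2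
  obtain ⟨a, ha, b, hb, hya, hyb, hab⟩ := exists_labels_ne hCU hyC hχ h2
  rcases eq_or_eq_of_adj hW hWU hy (hCW ha) (hCW hb) hz hya hyb hyz
    (hcyc.not_adj (by omega) hyC ha hb hya hyb) hχ hab with rfl | rfl
  · exact hzC ha
  · exact hzC hb

/-- If neighbors of the hole with different labels are always adjacent, then `W` is a clique. -/
theorem adj_of_labels_adj {W : Set V} (hW : F.graph.IsNonsep W) (hWU : W ⊆ F.U) {v : V}
    (hv : v ∈ W) {φ : V → K} (hφ : F.Good v φ) (h2 : 2 ≤ (F.labels W v φ).ncard)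
    (hadj : ∀ y ∈ W, ∀ ψ, F.Good y ψ → Set.EqOn φ ψ Wᶜ → ∀ a ∈ W, ∀ b ∈ W, F.graph.Adj y a →
      F.graph.Adj y b → F.label y ψ a ≠ F.label y ψ b → F.graph.Adj a b) :
    ∀ x ∈ W, ∀ y ∈ W, x ≠ y → F.graph.Adj x y := by
  -- All neighborhoods are cliques.
  have key : ∀ y ∈ W, ∀ a ∈ W, ∀ b ∈ W, F.graph.Adj y a → F.graph.Adj y b → a ≠ b →
      F.graph.Adj a b := by
    intro y hy a ha b hb hya hyb hne
    by_contra hab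
    obtain ⟨χ, hχ, heχ⟩ := exists_good_of_linkedIn hWU (hW.linked v hv y hy) hφ
    have hlab : F.label y χ a = F.label y χ b := by
      by_contra hl
      exact hab (hadj y hy χ hχ heχ.symm a ha b hb hya hyb hl)
    rw [ncard_labels_eq hW hWU hv hy hφ hχ heχ.symm] at h2
    obtain ⟨w, hw, hyw, hl⟩ : ∃ w ∈ W, F.graph.Adj y w ∧ F.label y χ w ≠ F.label y χ a := by
      obtain ⟨w, hw, w', hw', h1, h1', h3⟩ := exists_labels_ne hWU hy hχ h2
      by_cases h : F.label y χ w = F.label y χ a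
      · exact ⟨w', hw', h1', fun h' => h3 (h.trans h'.symm)⟩
      · exact ⟨w, hw, h1, h⟩
    have hwa := hadj y hy χ hχ heχ.symm w hw a ha hyw hya hl
    have hwb := hadj y hy χ hχ heχ.symm w hw b hb hyw hyb (hlab ▸ hl)
    have hU : ({y, w, a, b} : Set V) ⊆ F.U := by
      rintro x (rfl | rfl | rfl | rfl) <;> exact hWU ‹_›
    exact false_of_diamond hU hyw hya hyb hwa hwb hab hne (h := y) (by simp) hχ
      (two_le_ncard_labels hU (by simp) (by simp) (by simp) hχ hyw hya hl)
  intro x hx y hy hxy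
  by_contra hcon
  obtain ⟨a, ha, b, hb, hab, hpa, hpb⟩ := (hW.linked x hx y hy).exists_adj_of_not
    (p := fun a => x = a ∨ F.graph.Adj x a) (Or.inl rfl) (by push Not; exact ⟨hxy, hcon⟩)
  push Not at hpb
  rcases hpa with rfl | hpa
  · exact hpb.2 hab
  · exact hpb.2 (key a ha x hx b hb hpa.symm hab hpb.1)

/-- With more than one label, no direction occurs exactly once among the arcs of `S` at a vertex. -/
theorem exists_ne_E {S : Set V} (hS : F.graph.IsNonsep S) (hSU : S ⊆ F.U) {v u : V} (hv : v ∈ S)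
    (hu : u ∈ S) {s : Bool} (hE : F.E s v u) {φ : V → K} (hφ : F.Good v φ)
    (h2 : 2 ≤ (F.labels S v φ).ncard) : ∃ w ∈ S, w ≠ u ∧ F.E s v w := by
  rw [← signedLabels_eq_labels hS hSU hv hu hE hφ] at h2
  obtain ⟨x, ⟨hx, t, ht, htv, hA⟩, x', ⟨hx', t', ht', htv', hA'⟩, hne⟩ :=
    (Set.one_lt_ncard (Set.toFinite _)).1 h2
  by_cases htu : t = u
  · refine ⟨t', ht', ?_, F.arc_of hx' (F.mem hφ htv') hA'⟩
    rintro rfl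
    subst htu
    exact hne (F.inj hx hx' (F.mem hφ htv) hA hA')
  · exact ⟨t, ht, htu, F.arc_of hx (F.mem hφ htv) hA⟩

/-- A triangle with more than one label is bidirected. -/
theorem E_of_triangle {v u w : V} (hU : {w, v, u} ⊆ F.U) (hvu : F.graph.Adj v u)
    (hvw : F.graph.Adj v w) (huw : F.graph.Adj u w) {φ : V → K} (hφ : F.Good v φ)
    (hl : F.label v φ u ≠ F.label v φ w) (s : Bool) : F.E s v u := by
  have hS : F.graph.IsNonsep {w, v, u} :=
    hvu.isNonsep_pair.insert (by simp) (by simp) hvu.ne hvw.symm huw.symm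
  have h2 := two_le_ncard_labels hU (by simp) (by simp) (by simp) hφ hvu hvw hl
  have key : ∀ x ∈ ({w, v, u} : Set V), ∀ y ∈ ({w, v, u} : Set V), ∀ z ∈ ({w, v, u} : Set V),
      x ≠ z → y ≠ z → ∀ t, F.E t x y → F.E t x z := by
    intro x hx y hy z hz hxz hyz t ht
    obtain ⟨χ, hχ, heχ⟩ := exists_good_of_linkedIn hU (hS.linked v (by simp) x hx) hφ
    rw [ncard_labels_eq hS hU (by simp) hx hφ hχ heχ.symm] at h2
    obtain ⟨z', hz', hne, hE⟩ := exists_ne_E hS hU hx hy ht hχ h2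
    have hxz' := hE.adj.ne
    have hxy := ht.adj.ne
    have : z' = z := by
      simp only [Set.mem_insert_iff, Set.mem_singleton_iff] at hx hy hz hz'
      have := hvu.ne
      have := hvw.ne
      have := huw.ne
      grind
    rwa [← this]
  obtain ⟨t, ht⟩ := id hvu
  by_cases hst : s = t
  · rwa [hst]
  -- The signs alternate around the triangle.
  have h1 := key v (by simp) u (by simp) w (by simp) hvw.ne huw.ne t ht
  have h3 := key w (by simp) v (by simp) u (by simp) huw.ne' hvu.ne _ (F.E_not h1)
  have h4 := key u (by simp) w (by simp) v (by simp) hvu.ne' hvw.ne' _ (F.E_not h3)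
  have h5 := F.E_not h4
  rw [Bool.not_not] at h5
  rwa [show s = !t by cases s <;> cases t <;> simp_all]

end ShiftSystem

/-! ### Orientation and order of the cycles, and the classification -/

namespace ShiftSystem

variable {V K : Type*} {F : ShiftSystem V K} [Finite V] [Finite K]

/-- If there is only one label, the neighbors of `x` in `W` are all neighbors of the same color. -/
theorem ncard_E_le_of_ncard_labels_le_one {W : Set V} (hW : F.graph.IsNonsep W)
    (hWU : W ⊆ F.U) {v : V} (hv : v ∈ W) {φ : V → K} (hφ : F.Good v φ)
    (h1 : (F.labels W v φ).ncard ≤ 1) (s : Bool) {x : V} (hx : x ∈ W) :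
    {y | y ∈ W ∧ F.E s x y}.ncard ≤ F.d s := by
  obtain ⟨χ, hχ, heχ⟩ := exists_good_of_linkedIn hWU (hW.linked v hv x hx) hφ
  rw [ncard_labels_eq hW hWU hv hx hφ hχ heχ.symm] at h1
  rcases Set.eq_empty_or_nonempty {y | y ∈ W ∧ F.E s x y} with he | ⟨y, hy, hE⟩
  · simp [he]
  rw [← F.count hχ (hWU hx) (label_spec (hWU hx) hE.adj hχ).1 s]
  refine Set.ncard_le_ncard ?_ (Set.toFinite _)
  rintro z ⟨hz, hEz⟩
  refine ⟨hEz.adj.ne', ?_⟩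
  rw [(Set.ncard_le_one (Set.toFinite _)).1 h1 _ (label_mem_labels hWU hx hy hχ hE.adj) _
    (label_mem_labels hWU hx hz hχ hEz.adj)]
  exact arc_label (hWU hx) (hWU hz) hχ hEz

section Cycle

variable {c : ℕ → V} {N : ℕ} (hc : F.graph.IsInducedCycle c N)
  (hS : F.graph.IsNonsep (c '' Set.Iio N)) (hSU : c '' Set.Iio N ⊆ F.U) {φ : V → K} {v : V}
  (hv : v ∈ c '' Set.Iio N) (hφ : F.Good v φ)
  (h2 : 2 ≤ (F.labels (c '' Set.Iio N) v φ).ncard)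

include hc hS hSU hv hφ h2

theorem E_of_cycle {x y z : V} (hx : x ∈ c '' Set.Iio N) (hy : y ∈ c '' Set.Iio N)
    (hz : z ∈ c '' Set.Iio N) {s : Bool} (hxy : F.E s x y) (hxz : F.graph.Adj x z) :
    F.E s x z := by
  obtain ⟨χ, hχ, heχ⟩ := exists_good_of_linkedIn hSU (hS.linked v hv x hx) hφ
  rw [ncard_labels_eq hS hSU hv hx hφ hχ heχ.symm] at h2
  obtain ⟨w, hw, hwy, hE⟩ := exists_ne_E hS hSU hx hy hxy hχ h2
  rcases hc.eq_or_eq hx hy hw hz hxy.adj hE.adj hxz hwy.symm with rfl | rfl <;> assumption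

theorem bidirected_or_antidirected :
    (∀ x ∈ c '' Set.Iio N, ∀ y ∈ c '' Set.Iio N, F.graph.Adj x y → ∀ s, F.E s x y) ∨
      ∀ x ∈ c '' Set.Iio N, ∃ s, ∀ y ∈ c '' Set.Iio N, ¬ F.E s x y := by
  by_contra! hcon
  obtain ⟨⟨x, hx, y, hy, hxy, s, hs⟩, z, hz, hz'⟩ := hcon
  obtain ⟨a, ha, b, hb, hab, hpa, hpb⟩ := (hS.linked z hz x hx).exists_adj_of_not
    (p := fun a => ∀ s, ∃ y ∈ c '' Set.Iio N, F.E s a y) hz'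
    (fun h => by
      obtain ⟨w, hw, hE⟩ := h s
      exact hs (E_of_cycle hc hS hSU hv hφ h2 hx hw hy hE hxy))
  refine hpb fun t => ?_
  obtain ⟨w, hw, hE⟩ := hpa (!t)
  have h := F.E_not (E_of_cycle hc hS hSU hv hφ h2 ha hw hb hE hab)
  rw [Bool.not_not] at h
  exact ⟨a, ha, h⟩

theorem bidirected_of_odd (hN : Odd N) :
    ∀ x ∈ c '' Set.Iio N, ∀ y ∈ c '' Set.Iio N, F.graph.Adj x y → ∀ s, F.E s x y := by
  refine (bidirected_or_antidirected hc hS hSU hv hφ h2).resolve_right fun hanti => ?_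
  -- Sources and sinks alternate along the cycle.
  have hN3 := hc.three_le
  set g : ℕ → V := fun i => c (i % N) with hg
  have hmem : ∀ i, g i ∈ c '' Set.Iio N := fun i => ⟨i % N, Nat.mod_lt _ (by omega), rfl⟩
  have hstep : ∀ i, F.E true (g (i + 1)) (g (i + 2)) ↔ ¬ F.E true (g i) (g (i + 1)) := by
    intro i
    obtain ⟨s, hs⟩ := hanti (g (i + 1)) (hmem _)
    have hadj := hc.adj_mod (i + 1)
    have hadj' := (hc.adj_mod i).symm
    constructor
    · intro h h'
      have h3 := F.E_not h'
      cases s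
      · exact hs _ (hmem _) h3
      · exact hs _ (hmem _) h
    · intro h
      obtain ⟨t, ht⟩ := hadj'
      cases t
      · exact absurd (F.E_not ht) h
      · exact E_of_cycle hc hS hSU hv hφ h2 (hmem _) (hmem _) (hmem _) ht hadj
  have hpar : ∀ i, F.E true (g i) (g (i + 1)) ↔ (F.E true (g 0) (g 1) ↔ Even i) := by
    intro i
    induction i with
    | zero => simp
    | succ i ih =>
      rw [hstep, ih, Nat.even_add_one]
      tauto
  have h := hpar N
  rw [show g N = g 0 by simp [g], show g (N + 1) = g 1 by simp [g]] at h
  rw [← Nat.not_even_iff_odd] at hN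
  tauto

end Cycle

/-! If adjacent colors of the shift system have the same image under `col`, as is the case for list
colorings, then the images of the labels are the same in all positions of the hole. -/

omit [Finite K] in
theorem exists_color_eq {S : Set V} (hS : F.graph.IsNonsep S) (hSU : S ⊆ F.U) {L : Type*}
    {col : K → L} (hcol : ∀ s x y, F.A s x y → col x = col y) {v u : V} (hv : v ∈ S) (hu : u ∈ S)
    (hE : F.graph.Adj v u) {φ ψ : V → K} (hφ : F.Good v φ) (hψ : F.Good u ψ)
    (he : Set.EqOn φ ψ Sᶜ) {x : K} (hx : x ∈ F.labels S v φ) :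
    ∃ y ∈ F.labels S u ψ, col y = col x := by
  obtain ⟨s, hs⟩ := hE
  obtain ⟨y, hy, hA⟩ := exists_arc_signedLabels hS hSU hv hu hs hφ hψ he hx
  exact ⟨y, signedLabels_subset hy, (hcol _ _ _ hA).symm⟩

/-- In the list coloring case, the two colors alternate along the cycle from one neighbor of the
hole to the other, and the neighbors of the hole have different colors. -/
theorem odd_of_color {c : ℕ → V} {N : ℕ} (hc : F.graph.IsInducedCycle c N)
    (hS : F.graph.IsNonsep (c '' Set.Iio N)) (hSU : c '' Set.Iio N ⊆ F.U) {φ : V → K} {v : V}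
    (hv : v ∈ c '' Set.Iio N) (hφ : F.Good v φ)
    (h2 : 2 ≤ (F.labels (c '' Set.Iio N) v φ).ncard) {L : Type*}
    {col : K → L} (hcol : ∀ s x y, F.A s x y → col x = col y)
    (hinj : ∀ x, Set.InjOn col (F.X x)) : Odd N := by
  classical
  have hN3 := hc.three_le
  -- Start with the hole at `c 0`.
  obtain ⟨φ₀, hφ₀, he₀⟩ := exists_good_of_linkedIn hSU
    (hS.linked v hv (c 0) ⟨0, by simp; omega, rfl⟩) hφ
  have hmem : ∀ i < N, c i ∈ c '' Set.Iio N := fun i hi => ⟨i, hi, rfl⟩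
  rw [ncard_labels_eq hS hSU hv (hmem 0 (by omega)) hφ hφ₀ he₀.symm] at h2
  set S := c '' Set.Iio N with hSdef
  have hne : ∀ i j, i < N → j < N → i ≠ j → c i ≠ c j := fun i j hi hj hij h =>
    hij (hc.injOn hi hj h)
  have hadj : ∀ i, i + 1 < N → F.graph.Adj (c i) (c (i + 1)) := fun i hi =>
    (hc.adj_iff _ _ (by omega) hi).2 (Or.inl rfl)
  have hcoll : ∀ {x y : V} {χ : V → K}, x ∈ S → F.Good x χ → F.graph.Adj x y →
      col (F.label x χ y) = col (χ y) := by
    intro x y χ hx hχ hxy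
    obtain ⟨-, s, h⟩ := label_spec (hSU hx) hxy hχ
    exact hcol _ _ _ h
  -- The hole moves along the cycle.
  have hmove : ∀ i, i < N → ∃ χ, F.Good (c i) χ ∧ Set.EqOn φ₀ χ Sᶜ ∧
      (∀ j, i < j → j < N → χ (c j) = φ₀ (c j)) ∧
      (1 ≤ i → col (χ (c (i - 1))) = col (φ₀ (c i))) := by
    intro i
    induction i with
    | zero => exact fun _ => ⟨φ₀, hφ₀, fun _ _ => rfl, fun _ _ _ => rfl, by omega⟩
    | succ i ih =>
      intro hi
      obtain ⟨χ, hχ, he, hj, -⟩ := ih (by omega)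
      have hiS := hmem i (by omega)
      obtain ⟨hx, s, hA⟩ := label_spec (hSU hiS) (hadj i hi) hχ
      refine ⟨Function.update χ (c i) (F.label (c i) χ (c (i + 1))),
        F.shift hχ (hSU hiS) hx (hadj i hi).ne' hA (by simp) (fun w hw _ => by simp [hw]),
        ?_, ?_, ?_⟩
      · intro w hw
        have : w ≠ c i := by rintro rfl; exact hw hiS
        simp [this, he hw]
      · intro j hij hjN
        simp [hne j i hjN (by omega) (by omega), hj j (by omega) hjN]
      · intro _
        simp only [Nat.add_sub_cancel, Function.update_self]
        rw [hcoll hiS hχ (hadj i hi), hj (i + 1) (by omega) hi]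
  -- The hole at `x` has exactly two labels, on its two neighbors.
  have hlab : ∀ {x y z : V} {χ : V → K}, x ∈ S → y ∈ S → z ∈ S → F.Good x χ →
      Set.EqOn φ₀ χ Sᶜ → F.graph.Adj x y → F.graph.Adj x z → y ≠ z →
      col (χ y) ≠ col (χ z) ∧ ∀ l ∈ F.labels S x χ, col l = col (χ y) ∨ col l = col (χ z) := by
    intro x y z χ hx hy hz hχ he hxy hxz hyz
    have h2' := h2
    rw [ncard_labels_eq hS hSU (hmem 0 (by omega)) hx hφ₀ hχ he] at h2'
    have key : ∀ l ∈ F.labels S x χ, l = F.label x χ y ∨ l = F.label x χ z := by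
      intro l hl
      obtain ⟨w, hw, hxw, rfl⟩ := (mem_labels hSU hx hχ).1 hl
      rcases hc.eq_or_eq hx hy hz hw hxy hxz hxw hyz with rfl | rfl
      · exact Or.inl rfl
      · exact Or.inr rfl
    refine ⟨fun heq => ?_, fun l hl => ?_⟩
    · rw [← hcoll hx hχ hxy, ← hcoll hx hχ hxz] at heq
      have := hinj x (label_spec (hSU hx) hxy hχ).1 (label_spec (hSU hx) hxz hχ).1 heq
      obtain ⟨a, ha, b, hb, hab⟩ := (Set.one_lt_ncard (Set.toFinite _)).1 h2'
      rcases key a ha with rfl | rfl <;> rcases key b hb with rfl | rfl <;> simp_all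
    · rw [← hcoll hx hχ hxy, ← hcoll hx hχ hxz]
      rcases key l hl with rfl | rfl
      · exact Or.inl rfl
      · exact Or.inr rfl
  have halt : ∀ i, 1 ≤ i → i + 1 < N → ∃ χ, F.Good (c i) χ ∧ Set.EqOn φ₀ χ Sᶜ ∧
      col (φ₀ (c i)) ≠ col (φ₀ (c (i + 1))) ∧
      (∀ l ∈ F.labels S (c i) χ, col l = col (φ₀ (c i)) ∨ col l = col (φ₀ (c (i + 1)))) ∧
      ∃ l ∈ F.labels S (c i) χ, col l = col (φ₀ (c (i + 1))) := by
    intro i hi1 hi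
    obtain ⟨χ, hχ, he, hj, hprev⟩ := hmove i (by omega)
    have hp : F.graph.Adj (c i) (c (i - 1)) := by
      have := (hadj (i - 1) (by omega)).symm
      rwa [Nat.sub_add_cancel hi1] at this
    have hcl := hlab (hmem i (by omega)) (hmem (i - 1) (by omega)) (hmem (i + 1) hi) hχ he hp
      (hadj i hi) (hne _ _ (by omega) hi (by omega))
    rw [hprev hi1, hj (i + 1) (by omega) hi] at hcl
    refine ⟨χ, hχ, he, hcl.1, hcl.2, _,
      label_mem_labels hSU (hmem i (by omega)) (hmem _ hi) hχ (hadj i hi), ?_⟩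
    rw [hcoll (hmem i (by omega)) hχ (hadj i hi), hj (i + 1) (by omega) hi]
  have hperiod : ∀ i, 1 ≤ i → i + 2 < N → col (φ₀ (c (i + 2))) = col (φ₀ (c i)) := by
    intro i hi1 hi
    obtain ⟨χ, hχ, he, h3, h4, -⟩ := halt i hi1 (by omega)
    obtain ⟨χ', hχ', he', h3', -, l, hl, hl'⟩ := halt (i + 1) (by omega) (by omega)
    obtain ⟨l', hl2, hl2'⟩ := exists_color_eq hS hSU hcol (hmem (i + 1) (by omega))
      (hmem i (by omega)) (hadj i (by omega)).symm hχ' hχ (he'.symm.trans he) hl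
    rw [hl', show i + 1 + 1 = i + 2 from rfl] at hl2'
    rcases h4 l' hl2 with h | h
    · rw [← hl2', h]
    · exact absurd (h.symm.trans hl2') h3'
  have hodd : ∀ k, 2 * k + 1 < N → col (φ₀ (c (2 * k + 1))) = col (φ₀ (c 1)) := by
    intro k
    induction k with
    | zero => simp
    | succ k ih =>
      intro hk
      rw [← ih (by omega), ← hperiod (2 * k + 1) (by omega) (by omega)]
      rfl
  by_contra hcon
  rw [Nat.not_odd_iff_even] at hcon
  obtain ⟨k, hk⟩ := hcon
  have h0 : F.graph.Adj (c 0) (c (N - 1)) :=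
    (hc.adj_iff _ _ (by omega) (by omega)).2 (by omega)
  refine (hlab (hmem 0 (by omega)) (hmem 1 (by omega)) (hmem (N - 1) (by omega)) hφ₀
    (fun _ _ => rfl) (hadj 0 (by omega)) h0 (hne _ _ (by omega) (by omega) (by omega))).1 ?_
  rw [← hodd (k - 1) (by omega), show 2 * (k - 1) + 1 = N - 1 by omega]

/-- A nonseparable set `W` has degrees at most `d`, or is a complete bidirected graph, or is an
induced cycle with more than one label. -/
theorem classification {W : Set V} (hW : F.graph.IsNonsep W) (hWU : W ⊆ F.U)
    {v : V} (hv : v ∈ W) {φ : V → K} (hφ : F.Good v φ) :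
    (∀ x ∈ W, ∀ s, {y | y ∈ W ∧ F.E s x y}.ncard ≤ F.d s) ∨
    (∀ x ∈ W, ∀ y ∈ W, x ≠ y → ∀ s, F.E s x y) ∨
    ∃ N c, F.graph.IsInducedCycle c N ∧ W = c '' Set.Iio N ∧
      2 ≤ (F.labels (c '' Set.Iio N) v φ).ncard := by
  rcases Nat.lt_or_ge (F.labels W v φ).ncard 2 with h1 | h2
  · exact Or.inl fun x hx s =>
      ncard_E_le_of_ncard_labels_le_one hW hWU hv hφ (by omega) s hx
  refine Or.inr ?_
  by_cases hex : ∃ y ∈ W, ∃ ψ, F.Good y ψ ∧ Set.EqOn φ ψ Wᶜ ∧ ∃ a ∈ W, ∃ b ∈ W,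
      F.graph.Adj y a ∧ F.graph.Adj y b ∧ F.label y ψ a ≠ F.label y ψ b ∧ ¬ F.graph.Adj a b
  · obtain ⟨y, hy, ψ, hψ, -, a, ha, b, hb, hya, hyb, hl, hab⟩ := hex
    obtain ⟨N, c, hc, rfl⟩ := exists_isInducedCycle hW hWU hy ha hb hya hyb hab hψ hl
    exact Or.inr ⟨N, c, hc, rfl, h2⟩
  · push Not at hex
    have hadj := adj_of_labels_adj hW hWU hv hφ h2
      fun y hy ψ hψ he a ha b hb hya hyb hl => hex y hy ψ hψ he a ha b hb hya hyb hl
    refine Or.inl fun x hx y hy hxy s => ?_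
    obtain ⟨χ, hχ, heχ⟩ := exists_good_of_linkedIn hWU (hW.linked v hv x hx) hφ
    rw [ncard_labels_eq hW hWU hv hx hφ hχ heχ.symm] at h2
    obtain ⟨w, hw, hxw, hl⟩ : ∃ w ∈ W, F.graph.Adj x w ∧ F.label x χ y ≠ F.label x χ w := by
      obtain ⟨w, hw, w', hw', h1, h1', h3⟩ := exists_labels_ne hWU hx hχ h2
      by_cases h : F.label x χ y = F.label x χ w
      · exact ⟨w', hw', h1', fun h' => h3 (h.symm.trans h')⟩
      · exact ⟨w, hw, h1, h⟩
    have hyw : y ≠ w := by rintro rfl; exact hl rfl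
    refine E_of_triangle ?_ (hadj x hx y hy hxy) hxw (hadj y hy w hw hyw) hχ hl s
    rintro z (rfl | rfl | rfl) <;> exact hWU ‹_›

end ShiftSystem

namespace FinDigraph

/-! ### Digraph properties and their critical digraphs -/

/-- The arcs of `D` with a sign: `D.sAdj true v w` says that `vw` is an arc, and `D.sAdj false v w`
that `wv` is one. -/
def sAdj (D : FinDigraph.{u}) : Bool → D.V → D.V → Prop
  | true => D.Adj
  | false => fun v w => D.Adj w v

/-- The out-degree (sign `true`) or in-degree (sign `false`). -/
noncomputable def sDeg (D : FinDigraph.{u}) : Bool → D.V → ℕ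
  | true => D.outDeg
  | false => D.inDeg

/-- `d⁺(P)` (sign `true`) or `d⁻(P)` (sign `false`). -/
noncomputable def sBound (P : Set FinDigraph.{u}) : Bool → ℕ
  | true => dPlus P
  | false => dMinus P

theorem sDeg_eq (D : FinDigraph.{u}) (s : Bool) (v : D.V) :
    D.sDeg s v = {w | D.sAdj s v w}.ncard := by
  cases s <;> rfl

theorem sAdj_not {D : FinDigraph.{u}} {s : Bool} {v w : D.V} :
    D.sAdj (!s) v w ↔ D.sAdj s w v := by
  cases s <;> rfl

theorem not_sAdj_self (D : FinDigraph.{u}) (s : Bool) (v : D.V) : ¬ D.sAdj s v v := by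
  cases s <;> exact D.loopless v

theorem sAdj_iff_of_adj_iff {D E : FinDigraph.{u}} {f : D.V → E.V}
    (hf : ∀ a b, D.Adj a b ↔ E.Adj (f a) (f b)) (s : Bool) (a b : D.V) :
    D.sAdj s a b ↔ E.sAdj s (f a) (f b) := by
  cases s
  · exact hf b a
  · exact hf a b

theorem underlying_adj {D : FinDigraph.{u}} {v w : D.V} :
    D.underlying.Adj v w ↔ ∃ s, D.sAdj s v w := by
  constructor
  · rintro ⟨-, h | h⟩
    · exact ⟨true, h⟩
    · exact ⟨false, h⟩
  · rintro ⟨s, h⟩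
    refine ⟨fun he => D.not_sAdj_self s v (by rwa [← he] at h), ?_⟩
    cases s
    · exact Or.inr h
    · exact Or.inl h

section Property

variable {P : Set FinDigraph.{u}} (hP : IsReliable P)

include hP

theorem mem_of_embedding {D E : FinDigraph.{u}} {f : E.V → D.V} (hf : Function.Injective f)
    (hadj : ∀ a b, E.Adj a b ↔ D.Adj (f a) (f b)) (hD : D ∈ P) : E ∈ P := by
  refine hP.iso _ E (hP.hereditary D hD (Set.range f)) ⟨RelIso.symm ⟨Equiv.ofInjective f hf, ?_⟩⟩
  intro a b
  exact (hadj a b).symm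

theorem mem_of_isEmpty {D : FinDigraph.{u}} (h : IsEmpty D.V) : D ∈ P := by
  obtain ⟨E, hE, -⟩ := hP.exists_mem
  exact mem_of_embedding hP (f := fun v => h.elim v) (fun v => h.elim v) (fun v => h.elim v) hE

theorem mem_of_embedding_induce {D E : FinDigraph.{u}} {S : Set D.V} (hD : D.induce S ∈ P)
    {f : E.V → D.V} (hf : Function.Injective f) (hS : ∀ x, f x ∈ S)
    (hadj : ∀ a b, E.Adj a b ↔ D.Adj (f a) (f b)) : E ∈ P :=
  mem_of_embedding hP (f := fun x => (⟨f x, hS x⟩ : S))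
    (fun _ _ h => hf (congrArg Subtype.val h)) hadj hD

theorem exists_CR_subset {D : FinDigraph.{u}} {S : Set D.V} (hS : D.induce S ∉ P) :
    ∃ K ⊆ S, D.induce K ∈ CR P := by
  obtain ⟨K, hKS, hK⟩ := exists_minimal_le_of_wellFoundedLT (fun K => D.induce K ∉ P) S hS
  refine ⟨K, hKS, hK.1, fun v => ?_⟩
  obtain ⟨v, hv⟩ := v
  have h : D.induce (K \ {v}) ∈ P := by
    by_contra h
    exact (hK.2 h Set.sdiff_subset hv).2 rfl
  exact mem_of_embedding_induce hP h (f := fun x => x.1.1)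
    (fun x y hxy => Subtype.ext (Subtype.ext hxy))
    (fun x => ⟨x.1.2, fun h => x.2 (Subtype.ext h)⟩) fun _ _ => Iff.rfl

theorem CR_of_iso {D E : FinDigraph.{u}} {f : E.V → D.V} (hf : Function.Bijective f)
    (hadj : ∀ a b, E.Adj a b ↔ D.Adj (f a) (f b)) (hD : D ∈ CR P) : E ∈ CR P := by
  refine ⟨fun h => hD.1 ?_, fun v => ?_⟩
  · let e := Equiv.ofBijective f hf
    refine mem_of_embedding hP (f := e.symm) e.symm.injective (fun a b => ?_) h
    rw [hadj]
    change _ ↔ D.Adj (e (e.symm a)) (e (e.symm b))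
    simp
  · exact mem_of_embedding_induce hP (hD.2 (f v)) (f := fun x => f x.1)
      (fun x y hxy => Subtype.ext (hf.1 hxy)) (fun x h => x.2 (hf.1 h)) fun a b => hadj a.1 b.1

omit hP in
theorem sBound_le_sDeg {D : FinDigraph.{u}} (hD : D ∈ CR P) (s : Bool) (v : D.V) :
    sBound P s ≤ D.sDeg s v := by
  cases s
  · exact le_trans (Nat.sInf_le (Set.mem_image_of_mem _ hD)) (ciInf_le' _ v)
  · exact le_trans (Nat.sInf_le (Set.mem_image_of_mem _ hD)) (ciInf_le' _ v)

omit hP in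
theorem sDeg_induce (D : FinDigraph.{u}) {K : Set D.V} (s : Bool) (x : (D.induce K).V) :
    (D.induce K).sDeg s x = {y | y ∈ K ∧ D.sAdj s x.1 y}.ncard := by
  rw [sDeg_eq]
  refine (Set.ncard_image_of_injective (f := fun w : (D.induce K).V => w.1) _
    Subtype.val_injective).symm.trans (congrArg Set.ncard ?_)
  ext y
  constructor
  · rintro ⟨⟨y, hy⟩, hxy, rfl⟩
    exact ⟨hy, by cases s <;> exact hxy⟩
  · rintro ⟨hy, hxy⟩
    exact ⟨⟨y, hy⟩, by cases s <;> exact hxy, rfl⟩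

omit hP in
theorem sBound_le_of_CR {D : FinDigraph.{u}} {K : Set D.V} (hK : D.induce K ∈ CR P) {x : D.V}
    (hx : x ∈ K) (s : Bool) : sBound P s ≤ {y | y ∈ K ∧ D.sAdj s x y}.ncard :=
  le_of_le_of_eq (sBound_le_sDeg hK s (⟨x, hx⟩ : K)) (D.sDeg_induce s (⟨x, hx⟩ : K))

theorem induce_union_mem {D : FinDigraph.{u}} {S T : Set D.V} (hST : Disjoint S T)
    (h : ∀ x ∈ S, ∀ y ∈ T, ¬ D.Adj x y ∧ ¬ D.Adj y x) (hS : D.induce S ∈ P)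
    (hT : D.induce T ∈ P) : D.induce (S ∪ T) ∈ P := by
  classical
  refine hP.iso _ _ (hP.additive _ hS _ hT) ⟨⟨(Equiv.Set.union hST).symm, ?_⟩⟩
  rintro (⟨a, ha⟩ | ⟨a, ha⟩) (⟨b, hb⟩ | ⟨b, hb⟩)
  · change D.Adj ((Equiv.Set.union hST).symm (Sum.inl ⟨a, ha⟩)).1
      ((Equiv.Set.union hST).symm (Sum.inl ⟨b, hb⟩)).1 ↔
      Sum.LiftRel (D.induce S).Adj (D.induce T).Adj (Sum.inl ⟨a, ha⟩) (Sum.inl ⟨b, hb⟩)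
    rw [Equiv.Set.union_symm_apply_left, Equiv.Set.union_symm_apply_left]
    refine Iff.trans ?_ Sum.liftRel_inl_inl.symm
    exact Iff.rfl
  · exact iff_of_false (h a ha b hb).1 Sum.not_liftRel_inl_inr
  · exact iff_of_false (h b hb a ha).2 Sum.not_liftRel_inr_inl
  · change D.Adj ((Equiv.Set.union hST).symm (Sum.inr ⟨a, ha⟩)).1
      ((Equiv.Set.union hST).symm (Sum.inr ⟨b, hb⟩)).1 ↔
      Sum.LiftRel (D.induce S).Adj (D.induce T).Adj (Sum.inr ⟨a, ha⟩) (Sum.inr ⟨b, hb⟩)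
    rw [Equiv.Set.union_symm_apply_right, Equiv.Set.union_symm_apply_right]
    refine Iff.trans ?_ Sum.liftRel_inr_inr.symm
    exact Iff.rfl

/-- Additivity, for a digraph whose arcs join vertices of the same color. -/
theorem mem_of_forall_color {D : FinDigraph.{u}} {L : Type*} (col : D.V → L)
    (hcol : ∀ x y, D.Adj x y → col x = col y) (h : ∀ c, D.induce (col ⁻¹' {c}) ∈ P) : D ∈ P := by
  classical
  have key : ∀ s : Set L, s.Finite → D.induce (col ⁻¹' s) ∈ P := by
    intro s hs
    induction s, hs using Set.Finite.induction_on with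
    | empty => exact mem_of_isEmpty hP ⟨fun x => x.2⟩
    | @insert c s hc _ ih =>
      rw [Set.insert_eq, Set.preimage_union]
      refine induce_union_mem hP (Set.disjoint_left.2 fun x hx hx' => ?_) ?_ (h c) ih
      · rw [Set.mem_preimage, Set.mem_singleton_iff] at hx
        rw [Set.mem_preimage, hx] at hx'
        exact hc hx'
      · intro x hx y hy
        have hne : col x ≠ col y := fun he => hc (by
          rw [Set.mem_preimage, Set.mem_singleton_iff] at hx
          rw [← hx, he]
          exact hy)
        exact ⟨fun h => hne (hcol _ _ h), fun h => hne (hcol _ _ h).symm⟩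
  have huniv := key (Set.range col) (Set.finite_range _)
  rw [Set.preimage_range] at huniv
  exact mem_of_embedding hP (f := fun x => (⟨x, trivial⟩ : (Set.univ : Set D.V)))
    (fun x y hxy => congrArg Subtype.val hxy) (fun _ _ => Iff.rfl) huniv

end Property

/-! ### Partial transversals of covers -/

section Tight

variable {P : Set FinDigraph.{u}} (hP : IsReliable P) {D : FinDigraph.{u}} (C : D.Cover)

/-- `φ` chooses a `P`-transversal of the cover on `D - v`; the value `φ v` is irrelevant. -/
def Cover.IsGood (P : Set FinDigraph.{u}) (C : D.Cover) (v : D.V) (φ : D.V → C.H.V) : Prop :=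
  (∀ u, u ≠ v → φ u ∈ C.X u) ∧ C.H.induce (φ '' {v}ᶜ) ∈ P

variable {C}

theorem Cover.eq_of_mem {x : C.H.V} {u v : D.V} (hu : x ∈ C.X u) (hv : x ∈ C.X v) : u = v := by
  by_contra h
  exact Set.disjoint_left.1 (C.disjoint u v h) hu hv

theorem Cover.sAdj_of_sAdj {s : Bool} {x y : C.H.V} {u v : D.V} (hx : x ∈ C.X u) (hy : y ∈ C.X v)
    (h : C.H.sAdj s x y) : D.sAdj s u v := by
  have key : ∀ {x y : C.H.V} {u v : D.V}, x ∈ C.X u → y ∈ C.X v → C.H.Adj x y → D.Adj u v := by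
    intro x y u v hx hy h
    have hmem : (x, y) ∈ C.H.arcsBetween (C.X u) (C.X v) := ⟨hx, hy, h⟩
    by_contra hcon
    by_cases huv : u = v
    · subst huv
      rw [C.indep] at hmem
      exact hmem
    · rw [C.noArcs u v huv hcon] at hmem
      exact hmem
  cases s
  · exact key hy hx h
  · exact key hx hy h

theorem Cover.eq_of_sAdj {s : Bool} {x x' y : C.H.V} {u v : D.V} (hx : x ∈ C.X u)
    (hx' : x' ∈ C.X u) (hy : y ∈ C.X v) (h : C.H.sAdj s x y) (h' : C.H.sAdj s x' y) : x = x' := by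
  have hD := C.sAdj_of_sAdj hx hy h
  have huv : u ≠ v := by
    rintro rfl
    exact D.not_sAdj_self s u hD
  by_contra hne
  cases s
  · refine (C.matching v u huv.symm hD (x := (y, x)) ⟨hy, hx, h⟩ (y := (y, x'))
      ⟨hy, hx', h'⟩ ?_).1 rfl
    exact fun he => hne (Prod.ext_iff.1 he).2
  · refine (C.matching u v huv hD (x := (x, y)) ⟨hx, hy, h⟩ (y := (x', y))
      ⟨hx', hy, h'⟩ ?_).2.2.2 rfl
    exact fun he => hne (Prod.ext_iff.1 he).1

/-- The vertices `u ≠ v` of `D` whose chosen color `φ u` is a neighbor of `x` of sign `s`. -/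
def Cover.nbrs (C : D.Cover) (s : Bool) (v : D.V) (φ : D.V → C.H.V) (x : C.H.V) : Set D.V :=
  {u | u ≠ v ∧ C.H.sAdj s x (φ u)}

theorem ncard_le_nbrs {v : D.V} {φ : D.V → C.H.V} {x : C.H.V} {s : Bool} {K : Set C.H.V}
    (hK : K ⊆ insert x (φ '' {v}ᶜ)) :
    {y | y ∈ K ∧ C.H.sAdj s x y}.ncard ≤ (C.nbrs s v φ x).ncard := by
  refine (Set.ncard_le_ncard ?_ (Set.toFinite _)).trans
    (Set.ncard_image_le (f := φ) (Set.toFinite (C.nbrs s v φ x)))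
  rintro y ⟨hy, hxy⟩
  rcases hK hy with rfl | ⟨u, hu, rfl⟩
  · exact absurd hxy (C.H.not_sAdj_self _ _)
  · exact ⟨u, ⟨hu, hxy⟩, rfl⟩

include hP

/-- As `x` completes `φ` to a transversal, it lies in a member of `CR(P)`. -/
theorem sBound_le_nbrs (hno : ¬ ∃ T, C.IsTransversal T ∧ C.H.induce T ∈ P) {v : D.V}
    {φ : D.V → C.H.V} (hφ : C.IsGood P v φ) {x : C.H.V} (hx : x ∈ C.X v) (s : Bool) :
    sBound P s ≤ (C.nbrs s v φ x).ncard := by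
  have hT : C.H.induce (insert x (φ '' {v}ᶜ)) ∉ P := by
    intro hT
    refine hno ⟨_, fun w => ?_, hT⟩
    rw [Set.ncard_eq_one]
    by_cases hw : w = v
    · subst hw
      refine ⟨x, Set.eq_singleton_iff_unique_mem.2 ⟨⟨Or.inl rfl, hx⟩, ?_⟩⟩
      rintro y ⟨rfl | ⟨u, hu, rfl⟩, hy⟩
      · rfl
      · exact absurd (C.eq_of_mem (hφ.1 u hu) hy) hu
    · refine ⟨φ w, Set.eq_singleton_iff_unique_mem.2 ⟨⟨Or.inr ⟨w, hw, rfl⟩, hφ.1 w hw⟩, ?_⟩⟩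
      rintro y ⟨rfl | ⟨u, hu, rfl⟩, hy⟩
      · exact absurd (C.eq_of_mem hy hx) hw
      · rw [C.eq_of_mem (hφ.1 u hu) hy]
  obtain ⟨K, hKT, hK⟩ := exists_CR_subset hP hT
  have hxK : x ∈ K := by
    by_contra hxK
    exact hK.1 (mem_of_embedding_induce hP hφ.2 (f := fun y => y.1) Subtype.val_injective
      (fun y => (hKT y.2).resolve_left fun h => hxK (h ▸ y.2)) fun _ _ => Iff.rfl)
  exact (sBound_le_of_CR hK hxK s).trans (ncard_le_nbrs hKT)

/-- The degree bound at the hole, and its consequences in the case of equality.  The sets `C.nbrs`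
for the different `x ∈ X_v` are disjoint sets of neighbors of `v`. -/
theorem mul_sBound_le (hno : ¬ ∃ T, C.IsTransversal T ∧ C.H.induce T ∈ P) {k : ℕ}
    (hk : C.IsKCover k) {v : D.V} {φ : D.V → C.H.V} (hφ : C.IsGood P v φ) (s : Bool) :
    k * sBound P s ≤ D.sDeg s v ∧ (D.sDeg s v = k * sBound P s →
      (∀ x ∈ C.X v, (C.nbrs s v φ x).ncard = sBound P s) ∧
      ∀ u, D.sAdj s v u → ∃ x ∈ C.X v, C.H.sAdj s x (φ u)) := by
  classical
  have := Fintype.ofFinite D.V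
  have := Fintype.ofFinite C.H.V
  set t : C.H.V → Finset D.V := fun x => (C.nbrs s v φ x).toFinset
  have ht : ∀ x, (t x).card = (C.nbrs s v φ x).ncard := fun x =>
    (Set.ncard_eq_toFinset_card' _).symm
  have hdisj : ((C.X v).toFinset : Set C.H.V).PairwiseDisjoint t := by
    intro x hx x' hx' hne
    refine Finset.disjoint_left.2 fun u hu hu' => hne ?_
    simp only [Set.coe_toFinset] at hx hx'
    simp only [t, Set.mem_toFinset] at hu hu'
    exact C.eq_of_sAdj hx hx' (hφ.1 u hu.1) hu.2 hu'.2
  have hsub : (C.X v).toFinset.biUnion t ⊆ {u | D.sAdj s v u}.toFinset := by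
    intro u hu
    simp only [Finset.mem_biUnion, Set.mem_toFinset, t] at hu
    obtain ⟨x, hx, huv, hu⟩ := hu
    simpa using C.sAdj_of_sAdj hx (hφ.1 u huv) hu
  have hdeg : {u | D.sAdj s v u}.toFinset.card = D.sDeg s v := by
    rw [sDeg_eq, Set.ncard_eq_toFinset_card']
  have h1 := Finset.card_le_card hsub
  rw [Finset.card_biUnion hdisj, hdeg] at h1
  have hle : ∀ x ∈ (C.X v).toFinset, sBound P s ≤ (t x).card := by
    intro x hx
    rw [ht]
    exact sBound_le_nbrs hP hno hφ (by simpa using hx) s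
  have h2 := Finset.sum_le_sum hle
  rw [Finset.sum_const, smul_eq_mul, ← Set.ncard_eq_toFinset_card'] at h2
  have h3 : k * sBound P s ≤ (C.X v).ncard * sBound P s := Nat.mul_le_mul_right _ (hk v)
  refine ⟨h3.trans (h2.trans h1), fun heq => ⟨?_, ?_⟩⟩
  · have hsum : ∑ x ∈ (C.X v).toFinset, sBound P s = ∑ x ∈ (C.X v).toFinset, (t x).card := by
      rw [Finset.sum_const, smul_eq_mul, ← Set.ncard_eq_toFinset_card']
      omega
    intro x hx
    rw [← ht]
    exact ((Finset.sum_eq_sum_iff_of_le hle).1 hsum x (by simpa using hx)).symm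
  · intro u hu
    have hcard : {u | D.sAdj s v u}.toFinset.card ≤ ((C.X v).toFinset.biUnion t).card := by
      rw [Finset.card_biUnion hdisj, hdeg]
      omega
    have hmem : u ∈ (C.X v).toFinset.biUnion t := by
      rw [Finset.eq_of_subset_of_card_le hsub hcard]
      simpa using hu
    simp only [Finset.mem_biUnion, Set.mem_toFinset, t] at hmem
    obtain ⟨x, hx, -, h⟩ := hmem
    exact ⟨x, hx, h⟩

/-- If the degree bound is attained at the hole `v`, then a neighbor `u` of `v` can hand over
the hole. -/
theorem isGood_shift (hno : ¬ ∃ T, C.IsTransversal T ∧ C.H.induce T ∈ P) {k : ℕ}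
    (hk : C.IsKCover k) {v u : D.V} {φ ψ : D.V → C.H.V} (hφ : C.IsGood P v φ)
    (hv : ∀ s, D.sDeg s v = k * sBound P s) {x : C.H.V} {s : Bool} (hx : x ∈ C.X v) (huv : u ≠ v)
    (hxu : C.H.sAdj s x (φ u)) (hψv : ψ v = x) (hψ : ∀ w, w ≠ v → w ≠ u → ψ w = φ w) :
    C.IsGood P u ψ := by
  refine ⟨fun w hw => ?_, ?_⟩
  · by_cases hwv : w = v
    · subst hwv
      rwa [hψv]
    · rw [hψ w hwv hw]
      exact hφ.1 w hwv
  by_contra hbad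
  obtain ⟨K, hKT, hK⟩ := exists_CR_subset hP hbad
  -- A member of `CR(P)` among the chosen vertices contains `x`, but `x` has lost the neighbor `φ u`.
  have hsub : ∀ y ∈ K, y ≠ x → ∃ w, w ≠ v ∧ w ≠ u ∧ φ w = y := by
    intro y hy hyx
    obtain ⟨w, hw, rfl⟩ := hKT hy
    have hwv : w ≠ v := by rintro rfl; exact hyx hψv
    exact ⟨w, hwv, hw, (hψ w hwv hw).symm⟩
  have hxK : x ∈ K := by
    by_contra hxK
    refine hK.1 (mem_of_embedding_induce hP hφ.2 (f := fun y => y.1) Subtype.val_injective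
      (fun y => ?_) fun _ _ => Iff.rfl)
    obtain ⟨w, hwv, -, hw⟩ := hsub y.1 y.2 fun h => hxK (h ▸ y.2)
    exact ⟨w, hwv, hw⟩
  have h1 := sBound_le_of_CR hK hxK s
  rw [← ((mul_sBound_le hP hno hk hφ s).2 (hv s)).1 x hx] at h1
  have h2 : {y | y ∈ K ∧ C.H.sAdj s x y} ⊆ φ '' (C.nbrs s v φ x \ {u}) := by
    rintro y ⟨hy, hxy⟩
    obtain ⟨w, hwv, hwu, rfl⟩ := hsub y hy (by rintro rfl; exact C.H.not_sAdj_self _ _ hxy)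
    exact ⟨w, ⟨⟨hwv, hxy⟩, hwu⟩, rfl⟩
  have h3 := (Set.ncard_le_ncard h2 (Set.toFinite _)).trans (Set.ncard_image_le (Set.toFinite _))
  have h4 := Set.ncard_sdiff_singleton_lt_of_mem (s := C.nbrs s v φ x) (a := u) ⟨huv, hxu⟩
    (Set.toFinite _)
  omega

/-- The shift system of a cover without `P`-transversal; `U` consists of the vertices where the degree
bound is attained. -/
noncomputable def shiftSystem (C : D.Cover) (hno : ¬ ∃ T, C.IsTransversal T ∧ C.H.induce T ∈ P) {k : ℕ}
    (hk : C.IsKCover k) : ShiftSystem D.V C.H.V where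
  E := D.sAdj
  A := C.H.sAdj
  X := C.X
  d := sBound P
  U := {v | ∀ s, D.sDeg s v = k * sBound P s}
  Good := C.IsGood P
  E_not h := sAdj_not.2 (by simpa using h)
  E_irrefl := D.not_sAdj_self
  A_not h := sAdj_not.2 (by simpa using h)
  arc_of hx hy h := C.sAdj_of_sAdj hx hy h
  inj hx hx' hy h h' := C.eq_of_sAdj hx hx' hy h h'
  mem h hu := h.1 _ hu
  count hφ hv hx s := ((mul_sBound_le hP hno hk hφ s).2 (hv s)).1 _ hx
  exists_label hφ hv h := ((mul_sBound_le hP hno hk hφ _).2 (hv _)).2 _ h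
  shift hφ hv hx huv hA hψv hψ := isGood_shift hP hno hk hφ hv hx huv hA hψv hψ

end Tight

end FinDigraph

/-! ### Blocks of the subdigraph of vertices of minimum degree -/

theorem SimpleGraph.Reachable.linkedIn {V W : Type*} {G : SimpleGraph V} {G' : SimpleGraph W}
    {g : V → W} {R : Set W} (hg : ∀ a b, G.Adj a b → G'.Adj (g a) (g b)) (hR : ∀ a, g a ∈ R)
    {a b : V} (h : G.Reachable a b) : G'.LinkedIn R (g a) (g b) := by
  obtain ⟨p⟩ := h
  induction p with
  | nil => exact .refl _ _
  | cons h _ ih => exact ((hg _ _ h).linkedIn (hR _) (hR _)).trans ih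

namespace FinDigraph

theorem not_isSeparating_iff {D : FinDigraph.{u}} {v : D.V} :
    ¬ D.IsSeparating v ↔ (D.del v).underlying.Preconnected := by
  rw [IsSeparating, not_nontrivial_iff_subsingleton]
  exact ⟨fun h a b => SimpleGraph.ConnectedComponent.exact (Subsingleton.elim _ _),
    fun h => h.subsingleton_connectedComponent⟩

theorem isNonsep_range {Q : FinDigraph.{u}} {V : Type*} {G : SimpleGraph V} {f : Q.V → V}
    (hf : Function.Injective f) (hadj : ∀ s a b, Q.sAdj s a b → G.Adj (f a) (f b))
    (hconn : Q.IsConnected) (hsep : ∀ v, ¬ Q.IsSeparating v) : G.IsNonsep (Set.range f) where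
  linked := by
    rintro _ ⟨a, rfl⟩ _ ⟨b, rfl⟩
    refine (hconn.preconnected a b).linkedIn (g := f) (fun a b h => ?_) Set.mem_range_self
    obtain ⟨s, h⟩ := underlying_adj.1 h
    exact hadj s a b h
  linked_diff := by
    rintro x _ ⟨a, rfl⟩ hax _ ⟨b, rfl⟩ hbx
    by_cases hx : ∃ c, f c = x
    · obtain ⟨c, rfl⟩ := hx
      have h := not_isSeparating_iff.1 (hsep c) (⟨a, fun h => hax (congrArg f h)⟩ : ({c}ᶜ : Set Q.V))
        (⟨b, fun h => hbx (congrArg f h)⟩ : ({c}ᶜ : Set Q.V))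
      have hR : ∀ y : (Q.del c).V, f y.1 ∈ Set.range f \ {f c} := fun y =>
        ⟨⟨y.1, rfl⟩, fun h => y.2 (hf h)⟩
      refine h.linkedIn (g := fun y => f y.1) (fun a b h => ?_) hR
      obtain ⟨s, h⟩ := underlying_adj.1 h
      exact hadj s _ _ (by cases s <;> exact h)
    · have hR : ∀ a, f a ∈ Set.range f \ {x} := fun a => ⟨⟨a, rfl⟩, fun h => hx ⟨a, h⟩⟩
      refine (hconn.preconnected a b).linkedIn (g := f) (fun a b h => ?_) hR
      obtain ⟨s, h⟩ := underlying_adj.1 h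
      exact hadj s a b h

theorem sum_outDeg_eq_sum_inDeg (D : FinDigraph.{u}) [Fintype D.V] :
    ∑ v, D.outDeg v = ∑ v, D.inDeg v := by
  classical
  have h := Finset.sum_card_bipartiteAbove_eq_sum_card_bipartiteBelow D.Adj
    (s := Finset.univ) (t := Finset.univ)
  simp only [Finset.bipartiteAbove, Finset.bipartiteBelow] at h
  convert h using 2 with v _ v _
  · rw [outDeg, Set.ncard_eq_toFinset_card']
    simp
  · rw [inDeg, Set.ncard_eq_toFinset_card']
    simp

section Dibricks

variable {P : Set FinDigraph.{u}} {Q : FinDigraph.{u}} (hconn : Q.IsConnected)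

include hconn

/-- A connected digraph with `Δ(Q) ≤ d(P)` is a dibrick: if it is not in `P`, then it contains a member
of `CR(P)`, which has minimum degrees at least `d(P)` and hence is all of `Q`. -/
theorem isDibrick_of_sDeg_le (hP : IsReliable P) (h : ∀ s v, Q.sDeg s v ≤ sBound P s) :
    IsDibrick P Q := by
  refine ⟨hconn, Or.inr (Or.inr ?_)⟩
  by_cases hQ : Q ∈ P
  · exact Or.inl ⟨hQ, ⟨ciSup_le' (h true), ciSup_le' (h false)⟩⟩
  refine Or.inr ?_
  have hQ' : Q.induce Set.univ ∉ P := fun h => hQ <|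
    mem_of_embedding_induce hP h (f := id) Function.injective_id (fun _ => trivial)
      fun _ _ => Iff.rfl
  obtain ⟨K, -, hK⟩ := exists_CR_subset hP hQ'
  -- Every vertex of `K` has all its neighbors in `K`, by the bound on the degrees.
  have hclosed : ∀ v ∈ K, ∀ s w, Q.sAdj s v w → w ∈ K := by
    intro v hv s w hw
    have h1 : {y | y ∈ K ∧ Q.sAdj s v y} = {y | Q.sAdj s v y} :=
      Set.eq_of_subset_of_ncard_le (fun _ hy => hy.2)
        (by rw [← sDeg_eq]; exact (h s v).trans (sBound_le_of_CR hK hv s)) (Set.toFinite _)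
    exact (h1.symm.subset hw).1
  obtain ⟨v₀, hv₀⟩ : K.Nonempty := by
    by_contra hne
    rw [Set.not_nonempty_iff_eq_empty] at hne
    subst hne
    exact hK.1 (mem_of_isEmpty hP ⟨fun x => x.2⟩)
  have huniv : K = Set.univ := by
    refine Set.eq_univ_of_forall fun v => ?_
    obtain ⟨p⟩ := hconn.preconnected v₀ v
    induction p with
    | nil => exact hv₀
    | cons h _ ih =>
      obtain ⟨s, h⟩ := underlying_adj.1 h
      exact ih (hclosed _ hv₀ s _ h)
  subst huniv
  have hCR : Q ∈ CR P := CR_of_iso hP (f := fun v => (⟨v, trivial⟩ : (Set.univ : Set Q.V)))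
    ⟨fun _ _ h => congrArg Subtype.val h, fun v : (Q.induce Set.univ).V => ⟨v.1, rfl⟩⟩ (fun _ _ => Iff.rfl) hK
  have hdeg : ∀ s v, Q.sDeg s v = sBound P s := fun s v => (h s v).antisymm (sBound_le_sDeg hCR s v)
  have := Fintype.ofFinite Q.V
  have hsum : ∑ v, Q.sDeg true v = ∑ v, Q.sDeg false v := Q.sum_outDeg_eq_sum_inDeg
  rw [Finset.sum_congr rfl fun v _ => hdeg true v, Finset.sum_congr rfl fun v _ => hdeg false v,
    Finset.sum_const, Finset.sum_const, smul_eq_mul, smul_eq_mul] at hsum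
  have hpm : dPlus P = dMinus P :=
    Nat.eq_of_mul_eq_mul_left (Finset.card_pos.2 ⟨v₀, Finset.mem_univ _⟩) hsum
  refine ⟨hCR, fun v => ?_⟩
  have h1 : Q.outDeg v = dPlus P := hdeg true v
  have h2 : Q.inDeg v = dMinus P := hdeg false v
  omega

theorem isDibrick_of_complete (h : ∀ s v w, v ≠ w → Q.sAdj s v w) : IsDibrick P Q := by
  refine ⟨hconn, Or.inl ⟨Nat.card Q.V, ?_, ⟨⟨Finite.equivFin Q.V, ?_⟩⟩⟩⟩
  · have := hconn.nonempty
    exact Nat.card_pos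
  · intro v w
    change Finite.equivFin Q.V v ≠ Finite.equivFin Q.V w ↔ _
    rw [Ne, EmbeddingLike.apply_eq_iff_eq]
    exact ⟨fun hne => h true v w hne, fun had he => Q.not_sAdj_self true v (by rwa [← he] at had)⟩

end Dibricks

theorem cycleGraph_adj_iff {N : ℕ} (hN : 3 ≤ N) (i j : Fin N) :
    (SimpleGraph.cycleGraph N).Adj i j ↔ i.1 + 1 = j.1 ∨ j.1 + 1 = i.1 ∨
      i.1 = 0 ∧ j.1 + 1 = N ∨ j.1 = 0 ∧ i.1 + 1 = N := by
  have key : ∀ i j : Fin N, (i - j).1 = 1 ↔ j.1 + 1 = i.1 ∨ i.1 = 0 ∧ j.1 + 1 = N := by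
    intro i j
    have hi := i.2
    have hj := j.2
    rw [Fin.sub_def]
    simp only
    rcases Nat.lt_or_ge i.1 j.1 with h | h
    · rw [Nat.mod_eq_of_lt (by omega)]
      omega
    · rw [Nat.mod_eq_sub_mod (by omega), Nat.mod_eq_of_lt (by omega)]
      omega
  rw [SimpleGraph.cycleGraph_adj', key, key]
  omega

theorem exists_iso_cycleGraph {Q : FinDigraph.{u}} {V : Type*} {G : SimpleGraph V} {f : Q.V → V}
    (hf : Function.Injective f) (hadj : ∀ a b, Q.underlying.Adj a b ↔ G.Adj (f a) (f b))
    {c : ℕ → V} {N : ℕ} (hc : G.IsInducedCycle c N) (hr : Set.range f = c '' Set.Iio N) :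
    Nonempty (Q.underlying ≃g SimpleGraph.cycleGraph N) := by
  have h1 : ∀ i : Fin N, ∃ a, f a = c i := fun i => by
    have : c i ∈ Set.range f := hr ▸ ⟨i, i.2, rfl⟩
    exact this
  choose g hg using h1
  have hgb : Function.Bijective g := by
    constructor
    · intro i j hij
      exact Fin.ext (hc.injOn i.2 j.2 (by rw [← hg, ← hg, hij]))
    · intro a
      obtain ⟨i, hi, hia⟩ : f a ∈ c '' Set.Iio N := hr ▸ ⟨a, rfl⟩
      exact ⟨⟨i, hi⟩, hf (by rw [hg, hia])⟩
  refine ⟨(RelIso.symm ⟨Equiv.ofBijective g hgb, ?_⟩)⟩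
  intro i j
  change Q.underlying.Adj (g i) (g j) ↔ _
  rw [hadj, hg, hg, hc.adj_iff _ _ i.2 j.2, cycleGraph_adj_iff hc.three_le]

theorem isBidirectedCycle_of_iso {Q : FinDigraph.{u}} {N : ℕ} (hN : 3 ≤ N)
    (e : Q.underlying ≃g SimpleGraph.cycleGraph N)
    (h : ∀ v w, Q.underlying.Adj v w → ∀ s, Q.sAdj s v w) : Q.IsBidirectedCycle N := by
  refine ⟨hN, ⟨⟨e.toEquiv, ?_⟩⟩⟩
  intro v w
  change (SimpleGraph.cycleGraph N).Adj (e v) (e w) ↔ _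
  rw [e.map_adj_iff]
  exact ⟨fun hvw => h v w hvw true, fun hvw => underlying_adj.2 ⟨true, hvw⟩⟩

/-- The vertices of `H` are colored such that arcs join vertices of the same color, and the
vertices of each `X_v` have different colors; this is the case for covers given by lists. -/
def Cover.IsListCover {D : FinDigraph.{u}} (C : D.Cover) : Prop :=
  ∃ (L : Type u) (col : C.H.V → L), (∀ x y, C.H.Adj x y → col x = col y) ∧
    ∀ v, Set.InjOn col (C.X v)

section Block

variable {P : Set FinDigraph.{u}} (hP : IsReliable P) {D : FinDigraph.{u}} {C : D.Cover}
  (hno : ¬ ∃ T, C.IsTransversal T ∧ C.H.induce T ∈ P) {k : ℕ} (hk : C.IsKCover k)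

include hP hno hk

/-- The classification of shift systems, for a nonseparable induced subdigraph `Q` of `D`. -/
theorem block_cases_of_isGood {Q : FinDigraph.{u}} (hconn : Q.IsConnected)
    (hsep : ∀ v, ¬ Q.IsSeparating v) {f : Q.V → D.V} (hf : Function.Injective f)
    (hadj : ∀ a b, Q.Adj a b ↔ D.Adj (f a) (f b)) (hU : ∀ a s, D.sDeg s (f a) = k * sBound P s)
    {v : Q.V} {φ : D.V → C.H.V} (hφ : C.IsGood P (f v) φ) :
    IsDibrick P Q ∨ ¬ C.IsListCover ∧
      ((∃ n, Even n ∧ Q.IsBidirectedCycle n) ∨ Q.IsAntidirectedCycle) := by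
  set F := shiftSystem hP C hno hk with hF
  have hsadj : ∀ s a b, Q.sAdj s a b ↔ F.E s (f a) (f b) := sAdj_iff_of_adj_iff hadj
  have hW : F.graph.IsNonsep (Set.range f) :=
    isNonsep_range hf (fun s a b h => ((hsadj s a b).1 h).adj) hconn hsep
  have hWU : Set.range f ⊆ F.U := by
    rintro _ ⟨a, rfl⟩
    exact hU a
  have hv : f v ∈ Set.range f := ⟨v, rfl⟩
  have hund : ∀ a b, Q.underlying.Adj a b ↔ F.graph.Adj (f a) (f b) := fun a b =>
    underlying_adj.trans (exists_congr fun s => hsadj s a b)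
  rcases ShiftSystem.classification hW hWU hv hφ with h | h | ⟨N, c, hc, hr, h2⟩
  · refine Or.inl (isDibrick_of_sDeg_le hconn hP fun s a => ?_)
    refine le_trans (le_of_eq ?_) (h (f a) ⟨a, rfl⟩ s)
    rw [sDeg_eq, ← Set.ncard_image_of_injective _ hf]
    congr 1
    ext y
    constructor
    · rintro ⟨b, hb, rfl⟩
      exact ⟨⟨b, rfl⟩, (hsadj s a b).1 hb⟩
    · rintro ⟨⟨b, rfl⟩, hb⟩
      exact ⟨b, (hsadj s a b).2 hb, rfl⟩
  · exact Or.inl (isDibrick_of_complete hconn fun s a b hab =>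
      (hsadj s a b).2 (h _ ⟨a, rfl⟩ _ ⟨b, rfl⟩ (hf.ne hab) s))
  · obtain ⟨e⟩ := exists_iso_cycleGraph hf hund hc hr
    have hbi : (∀ x ∈ c '' Set.Iio N, ∀ y ∈ c '' Set.Iio N, F.graph.Adj x y → ∀ s, F.E s x y) →
        Q.IsBidirectedCycle N := fun h => isBidirectedCycle_of_iso hc.three_le e fun a b hab s =>
      (hsadj s a b).2 (h _ (hr ▸ ⟨a, rfl⟩) _ (hr ▸ ⟨b, rfl⟩) ((hund a b).1 hab) s)
    have hW' := hW
    have hWU' := hWU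
    have hv' := hv
    rw [hr] at hW' hWU' hv'
    by_cases hodd : Odd N
    · refine Or.inl ⟨hconn, Or.inr (Or.inl ⟨N, hodd, hbi ?_⟩)⟩
      exact ShiftSystem.bidirected_of_odd hc hW' hWU' hv' hφ h2 hodd
    · refine Or.inr ⟨?_, ?_⟩
      · rintro ⟨L, col, hcol, hinj⟩
        refine hodd (ShiftSystem.odd_of_color hc hW' hWU' hv' hφ h2 (col := col) ?_ hinj)
        intro s x y hxy
        cases s
        · exact (hcol _ _ hxy).symm
        · exact hcol _ _ hxy
      · rcases ShiftSystem.bidirected_or_antidirected hc hW' hWU' hv' hφ h2 with h | h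
        · exact Or.inl ⟨N, Nat.not_odd_iff_even.1 hodd, hbi h⟩
        · refine Or.inr ⟨⟨N, hc.three_le, ⟨e⟩⟩, fun a => ?_⟩
          obtain ⟨s, hs⟩ := h (f a) (hr ▸ ⟨a, rfl⟩)
          have hempty : Q.sDeg s a = 0 := by
            rw [sDeg_eq, Set.ncard_eq_zero]
            exact Set.eq_empty_of_forall_notMem fun b hb =>
              hs (f b) (hr ▸ ⟨b, rfl⟩) ((hsadj s a b).1 hb)
          cases s
          · exact Or.inl hempty
          · exact Or.inr hempty

end Block

/-- Blocks are induced subdigraphs, by maximality. -/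
theorem isBlock_adj_iff {D : FinDigraph.{u}} {B : D.Subdigraph} (hB : IsBlock B) {v w : D.V}
    (hv : v ∈ B.verts) (hw : w ∈ B.verts) : B.Adj v w ↔ D.Adj v w := by
  refine ⟨B.adj_sub, fun h => ?_⟩
  let A : D.Subdigraph :=
    { verts := B.verts
      Adj := fun v w => v ∈ B.verts ∧ w ∈ B.verts ∧ D.Adj v w
      adj_sub := fun h => h.2.2
      tail_mem := fun h => h.1
      head_mem := fun h => h.2.1 }
  have hBA : B ≤ A := ⟨subset_rfl, fun v w h => ⟨B.tail_mem h, B.head_mem h, B.adj_sub h⟩⟩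
  refine (hB.2 (y := A) ⟨?_, fun v => not_isSeparating_iff.2 ?_⟩ hBA).2 v w ⟨hv, hw, h⟩
  · refine SimpleGraph.Connected.mono ?_ hB.1.1
    rintro a b ⟨hne, h⟩
    exact ⟨hne, h.imp (hBA.2 _ _) (hBA.2 _ _)⟩
  · have h := not_isSeparating_iff.1 (hB.1.2 (show B.coe.V from v))
    refine h.mono (G' := (A.coe.del v).underlying) ?_
    rintro a b ⟨hne, h⟩
    exact ⟨hne, h.imp (hBA.2 _ _) (hBA.2 _ _)⟩

/-! In the following statements, `C` has no `P`-transversal, but each of the covers `C - v` has one. -/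

section Critical

variable {P : Set FinDigraph.{u}} (hP : IsReliable P) {D : FinDigraph.{u}} {C : D.Cover}
  (hno : ¬ ∃ T, C.IsTransversal T ∧ C.H.induce T ∈ P) {k : ℕ} (hk : C.IsKCover k)
  (hT : ∀ v, ∃ T, C.H.induce T ∈ P ∧ ∀ u ≠ v, (T ∩ C.X u).ncard = 1)

include hP

omit hP in
theorem exists_choice_of_ncard_eq_one [Nonempty C.H.V] {v : D.V} {T : Set C.H.V}
    (h : ∀ u ≠ v, (T ∩ C.X u).ncard = 1) : ∃ φ : D.V → C.H.V, ∀ u ≠ v, φ u ∈ T ∩ C.X u := by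
  have : ∀ u, ∃ x, u ≠ v → x ∈ T ∩ C.X u := by
    intro u
    by_cases hu : u = v
    · exact ⟨Classical.arbitrary _, fun h => absurd hu h⟩
    · obtain ⟨x, hx⟩ := (Set.ncard_pos (Set.toFinite _)).1 (by rw [h u hu]; exact one_pos)
      exact ⟨x, fun _ => hx⟩
  choose φ hφ using this
  exact ⟨φ, hφ⟩

include hT

theorem exists_isGood [Nonempty C.H.V] (v : D.V) : ∃ φ, C.IsGood P v φ := by
  obtain ⟨T, hTP, h⟩ := hT v
  obtain ⟨φ, hφ⟩ := exists_choice_of_ncard_eq_one h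
  refine ⟨φ, fun u hu => (hφ u hu).2, ?_⟩
  refine mem_of_embedding_induce hP hTP (f := fun x => x.1) Subtype.val_injective ?_
    fun _ _ => Iff.rfl
  rintro ⟨_, u, hu, rfl⟩
  exact (hφ u hu).1

include hno hk

/-- If `k = 0`, then the sets `X_v` may be empty, and there need not be any `φ` as above. -/
theorem mul_sBound_le_sDeg (s : Bool) (v : D.V) : k * sBound P s ≤ D.sDeg s v := by
  rcases Nat.eq_zero_or_pos k with rfl | hk0
  · simp
  obtain ⟨x, -⟩ := (Set.ncard_pos (Set.toFinite _)).1 (hk0.trans_le (hk v))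
  have : Nonempty C.H.V := ⟨x⟩
  obtain ⟨φ, hφ⟩ := exists_isGood hP hT v
  exact (mul_sBound_le hP hno hk hφ s).1

theorem smul_dPair_le_minDeg [Nonempty D.V] : k • dPair P ≤ D.minDeg :=
  ⟨le_ciInf fun v => mul_sBound_le_sDeg hP hno hk hT true v,
    le_ciInf fun v => mul_sBound_le_sDeg hP hno hk hT false v⟩

theorem block_cases {B : (D.induce {v | D.deg v = k • dPair P}).Subdigraph} (hB : IsBlock B) :
    IsDibrick P B.coe ∨ ¬ C.IsListCover ∧
      ((∃ n, Even n ∧ B.coe.IsBidirectedCycle n) ∨ B.coe.IsAntidirectedCycle) := by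
  have hconn := hB.1.1
  have hsub : ∀ a b : B.coe.V, B.coe.Adj a b ↔ D.Adj a.1.1 b.1.1 := fun a b =>
    isBlock_adj_iff hB a.2 b.2
  rcases subsingleton_or_nontrivial B.coe.V with hs | ⟨a, b, hab⟩
  · exact Or.inl (isDibrick_of_complete hconn fun s v w h => absurd (Subsingleton.elim v w) h)
  have hinj : Function.Injective fun a : B.coe.V => a.1.1 :=
    fun a b h => Subtype.ext (Subtype.ext h)
  have : Nonempty C.H.V := by
    obtain ⟨T, -, h⟩ := hT a.1.1
    obtain ⟨x, -⟩ := (Set.ncard_pos (Set.toFinite _)).1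
      (by rw [h b.1.1 (hinj.ne hab.symm)]; exact one_pos)
    exact ⟨x⟩
  obtain ⟨φ, hφ⟩ := exists_isGood hP hT a.1.1
  refine block_cases_of_isGood hP hno hk hconn hB.1.2 hinj hsub (fun a s => ?_) (v := a) hφ
  have h : D.deg a.1.1 = k • dPair P := a.1.2
  cases s
  · exact congrArg Prod.snd h
  · exact congrArg Prod.fst h

end Critical

end FinDigraph

namespace FinDigraph

/-! ### Coloring parameters and covers of critical digraphs -/

/-- The cover of `D - v` that is obtained by deleting `X_v`. -/
def Cover.del {D : FinDigraph.{u}} (C : D.Cover) (v : D.V) : (D.del v).Cover where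
  H := C.H.induce (C.X v)ᶜ
  X u := {x | x.1 ∈ C.X u.1}
  disjoint u w h := Set.disjoint_left.2 fun _ hx hx' => h (Subtype.ext (C.eq_of_mem hx hx'))
  iUnion_eq := by
    refine Set.eq_univ_of_forall fun x => ?_
    obtain ⟨u, hu⟩ := Set.mem_iUnion.1 (C.iUnion_eq ▸ Set.mem_univ x.1)
    have huv : u ≠ v := by
      rintro rfl
      exact x.2 hu
    exact Set.mem_iUnion.2 ⟨(⟨u, huv⟩ : ({v}ᶜ : Set D.V)), hu⟩
  indep u := by
    refine Set.eq_empty_of_forall_notMem fun a ha => ?_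
    have h : (a.1.1, a.2.1) ∈ C.H.arcsBetween (C.X u.1) (C.X u.1) := ha
    rw [C.indep] at h
    exact h
  matching u w h hadj a ha b hb hab := by
    have h' := C.matching u.1 w.1 (fun e => h (Subtype.ext e)) hadj
      (x := (a.1.1, a.2.1)) ha (y := (b.1.1, b.2.1)) hb
      (fun e => hab (Prod.ext (Subtype.ext (Prod.ext_iff.1 e).1)
        (Subtype.ext (Prod.ext_iff.1 e).2)))
    exact ⟨fun e => h'.1 (congrArg Subtype.val e), fun e => h'.2.1 (congrArg Subtype.val e),
      fun e => h'.2.2.1 (congrArg Subtype.val e), fun e => h'.2.2.2 (congrArg Subtype.val e)⟩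
  noArcs u w h hadj := by
    refine Set.eq_empty_of_forall_notMem fun a ha => ?_
    have h' : (a.1.1, a.2.1) ∈ C.H.arcsBetween (C.X u.1) (C.X w.1) := ha
    rw [C.noArcs u.1 w.1 (fun e => h (Subtype.ext e)) hadj] at h'
    exact h'

variable {P : Set FinDigraph.{u}} {D : FinDigraph.{u}}

theorem image_val_inter_X {C : D.Cover} {v u : D.V} (hu : u ≠ v) (T : Set (C.del v).H.V) :
    (fun x : (C.del v).H.V => x.1) '' T ∩ C.X u =
      (fun x : (C.del v).H.V => x.1) '' (T ∩ (C.del v).X (⟨u, hu⟩ : ({v}ᶜ : Set D.V))) := by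
  ext x
  constructor
  · rintro ⟨⟨x, hx, rfl⟩, hxu⟩
    exact ⟨x, ⟨hx, hxu⟩, rfl⟩
  · rintro ⟨x, ⟨hx, hxu⟩, rfl⟩
    exact ⟨⟨x, hx, rfl⟩, hxu⟩

theorem DPColorable.exists_partial_transversal (hP : IsReliable P) {k : ℕ} {C : D.Cover}
    (hk : C.IsKCover k) {v : D.V} (h : DPColorable P (D.del v) k) :
    ∃ T, C.H.induce T ∈ P ∧ ∀ u ≠ v, (T ∩ C.X u).ncard = 1 := by
  have hval : Function.Injective fun x : (C.del v).H.V => x.1 := Subtype.val_injective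
  obtain ⟨T, hT, hTP⟩ := h (C.del v) fun u => by
    refine (hk u.1).trans (le_of_eq ?_)
    rw [← Set.ncard_image_of_injective _ hval]
    congr 1
    ext x
    constructor
    · intro hx
      exact ⟨(⟨x, fun hxv => u.2 (C.eq_of_mem hx hxv)⟩ : ((C.X v)ᶜ : Set C.H.V)), hx, rfl⟩
    · rintro ⟨x, hx, rfl⟩
      exact hx
  refine ⟨(fun x : (C.del v).H.V => x.1) '' T, ?_, fun u hu => ?_⟩
  · have hmem : ∀ x : C.H.V, x ∈ (fun x : (C.del v).H.V => x.1) '' T → x ∈ (C.X v)ᶜ := by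
      rintro _ ⟨x, -, rfl⟩
      exact x.2
    refine mem_of_embedding_induce hP hTP
      (f := fun x => (⟨x.1, hmem x.1 x.2⟩ : ((C.X v)ᶜ : Set C.H.V))) ?_ ?_ fun _ _ => Iff.rfl
    · exact fun x y hxy => Subtype.ext (congrArg (fun z : (C.del v).H.V => z.1) hxy)
    · rintro ⟨_, x, hx, rfl⟩
      exact hx
  · rw [image_val_inter_X hu, Set.ncard_image_of_injective _ hval]
    exact hT _

/-! ### Covers given by lists -/

section ListCover

variable {L : Type u} (A : D.V → Set L) [∀ v, Finite (A v)]

/-- The cover of `D` given by the lists `A v`: the vertices of `H` are the pairs of a vertex and a color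
of its list, and each arc of `D` joins equal colors.  Its transversals are the list colorings. -/
def listCover (D : FinDigraph.{u}) (A : D.V → Set L) [∀ v, Finite (A v)] : D.Cover where
  H :=
    { V := Σ v, A v
      graph := ⟨fun x y => D.Adj x.1 y.1 ∧ x.2.1 = y.2.1⟩
      loopless := fun x h => D.loopless x.1 h.1 }
  X v := {x | x.1 = v}
  disjoint u v h := Set.disjoint_left.2 fun x hx hx' => h (hx.symm.trans hx')
  iUnion_eq := Set.eq_univ_of_forall fun x => Set.mem_iUnion.2 ⟨x.1, rfl⟩
  indep v := by
    refine Set.eq_empty_of_forall_notMem ?_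
    rintro ⟨x, y⟩ ⟨hx, hy, h, -⟩
    change x.1 = v at hx
    change y.1 = v at hy
    exact D.loopless v (by rwa [hx, hy] at h)
  matching u w huw _ := by
    rintro ⟨⟨u₁, c₁⟩, ⟨w₁, d₁⟩⟩ ⟨rfl, rfl, -, h₁⟩ ⟨⟨u₂, c₂⟩, ⟨w₂, d₂⟩⟩ ⟨rfl, h, -, h₂⟩ hne
    obtain rfl : w₂ = w₁ := h
    simp only at h₁ h₂ huw
    refine ⟨fun e => hne ?_, fun e => huw (congrArg Sigma.fst e),
      fun e => huw (congrArg Sigma.fst e).symm, fun e => hne ?_⟩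
    · have e1 : c₁ = c₂ := eq_of_heq (Sigma.mk.inj e).2
      have e2 : d₁ = d₂ := Subtype.ext (by rw [← h₁, ← h₂, e1])
      rw [e1, e2]
    · have e1 : d₁ = d₂ := eq_of_heq (Sigma.mk.inj e).2
      have e2 : c₁ = c₂ := Subtype.ext (by rw [h₁, h₂, e1])
      rw [e1, e2]
  noArcs u v _ hadj := by
    refine Set.eq_empty_of_forall_notMem ?_
    rintro ⟨x, y⟩ ⟨hx, hy, h, -⟩
    change x.1 = u at hx
    change y.1 = v at hy
    exact hadj (by rwa [hx, hy] at h)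

theorem listCover_isListCover : (listCover D A).IsListCover := by
  refine ⟨L, fun x => x.2.1, fun x y h => h.2, fun v => ?_⟩
  rintro ⟨x, c⟩ hx ⟨y, d⟩ hy h
  obtain rfl : x = v := hx
  obtain rfl : y = x := hy
  obtain rfl : c = d := Subtype.ext h
  rfl

theorem listCover_X_eq_range (v : D.V) :
    (listCover D A).X v = Set.range fun c : A v => (⟨v, c⟩ : Σ v, A v) := by
  ext ⟨x, c⟩
  constructor
  · rintro rfl
    exact ⟨c, rfl⟩
  · rintro ⟨d, hd⟩
    exact (congrArg Sigma.fst hd).symm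

theorem listCover_isKCover {k : ℕ} (hk : ∀ v, k ≤ (A v).ncard) :
    (listCover D A).IsKCover k := by
  intro v
  refine (hk v).trans (le_of_eq ?_)
  rw [listCover_X_eq_range]
  refine Eq.trans ?_ (Set.ncard_image_of_injective (f := fun c : A v => (⟨v, c⟩ : Σ v, A v))
    Set.univ fun c d h => eq_of_heq (Sigma.mk.inj h).2).symm |>.trans (by rw [Set.image_univ]; rfl)
  rw [Set.ncard_univ]
  rfl

theorem exists_coloring_of_isTransversal (hP : IsReliable P) {T : Set (listCover D A).H.V}
    (hT : (listCover D A).IsTransversal T) (hTP : (listCover D A).H.induce T ∈ P) :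
    ∃ φ : D.V → L, (∀ v, φ v ∈ A v) ∧ ∀ c, D.induce (φ ⁻¹' {c}) ∈ P := by
  have h : ∀ v, ∃ c : A v, (⟨v, c⟩ : Σ v, A v) ∈ T := by
    intro v
    obtain ⟨⟨x, c⟩, hxT, hx⟩ := (Set.ncard_pos (Set.toFinite _)).1
      (by rw [hT v]; exact one_pos)
    obtain rfl : x = v := hx
    exact ⟨c, hxT⟩
  choose φ hφ using h
  refine ⟨fun v => (φ v).1, fun v => (φ v).2, fun c => ?_⟩
  refine mem_of_embedding_induce hP hTP (f := fun v => (⟨v.1, φ v.1⟩ : Σ v, A v)) ?_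
    (fun v => hφ v.1) ?_
  · exact fun v w h => Subtype.ext (congrArg Sigma.fst h)
  · exact fun v w => ⟨fun h => ⟨h, v.2.trans w.2.symm⟩, fun h => h.1⟩

/-- A transversal of a list cover is in `P` if its color classes are, since no arcs join different
colors. -/
theorem exists_partial_transversal_of_coloring (hP : IsReliable P) {v : D.V} {φ : (D.del v).V → L}
    (hφ : ∀ u, φ u ∈ A u.1) (hφP : ∀ c, (D.del v).induce (φ ⁻¹' {c}) ∈ P) :
    ∃ T, (listCover D A).H.induce T ∈ P ∧ ∀ u ≠ v, (T ∩ (listCover D A).X u).ncard = 1 := by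
  let t : (D.del v).V → (listCover D A).H.V := fun u => (⟨u.1, φ u, hφ u⟩ : Σ v, A v)
  have ht : ∀ x : ((listCover D A).H.induce (Set.range t)).V, ∃ u, t u = x.1 := fun x => x.2
  choose g hg using ht
  refine ⟨Set.range t, ?_, fun u hu => ?_⟩
  · refine mem_of_forall_color hP (fun x => x.1.2.1) (fun x y h => h.2) fun c => ?_
    refine mem_of_embedding_induce hP (hφP c) (f := fun x => g x.1) ?_ ?_ ?_
    · intro x y hxy
      have : x.1.1 = y.1.1 := by rw [← hg, ← hg]; exact congrArg t hxy
      exact Subtype.ext (Subtype.ext this)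
    · intro x
      have h1 : (t (g x.1)).2.1 = c := by
        rw [hg]
        exact x.2
      exact h1
    · intro x y
      have hx : (g x.1).1 = x.1.1.1 := congrArg Sigma.fst (hg x.1)
      have hy : (g y.1).1 = y.1.1.1 := congrArg Sigma.fst (hg y.1)
      change D.Adj x.1.1.1 y.1.1.1 ∧ x.1.1.2.1 = y.1.1.2.1 ↔ D.Adj (g x.1).1 (g y.1).1
      rw [hx, hy]
      exact ⟨fun h => h.1, fun h => ⟨h, x.2.trans y.2.symm⟩⟩
  · rw [Set.ncard_eq_one]
    refine ⟨t (⟨u, hu⟩ : ({v}ᶜ : Set D.V)), Set.eq_singleton_iff_unique_mem.2 ⟨⟨⟨_, rfl⟩, rfl⟩, ?_⟩⟩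
    rintro _ ⟨⟨w, rfl⟩, hw⟩
    have hwu : w.1 = u := hw
    have : w = (⟨u, hu⟩ : ({v}ᶜ : Set D.V)) := Subtype.ext hwu
    rw [this]

end ListCover

/-! ### Criticality and degrees -/

theorem DPColorable.mono {k l : ℕ} (hkl : k ≤ l) (h : DPColorable P D k) : DPColorable P D l :=
  fun C hC => h C fun v => hkl.trans (hC v)

theorem ListColorable.mono {k l : ℕ} (hkl : k ≤ l) (h : ListColorable P D k) :
    ListColorable P D l :=
  fun C L hL => h C L fun v => (Nat.cast_le.2 hkl).trans (hL v)

theorem Colorable.mono (hP : IsReliable P) {k l : ℕ} (hkl : k ≤ l) (h : Colorable P D k) :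
    Colorable P D l := by
  obtain ⟨φ, hφ⟩ := h
  refine ⟨fun v => Fin.castLE hkl (φ v), fun c => ?_⟩
  by_cases hc : ∃ v, Fin.castLE hkl (φ v) = c
  · obtain ⟨v, rfl⟩ := hc
    refine mem_of_embedding_induce hP (hφ (φ v)) (f := fun x => x.1) Subtype.val_injective
      (fun x => ?_) fun _ _ => Iff.rfl
    exact Fin.castLE_injective hkl x.2
  · exact mem_of_isEmpty hP ⟨fun x => hc ⟨x.1, x.2⟩⟩

/-- Lists may be infinite, whereas covers are finite. -/
theorem exists_finite_lists {k : ℕ} {L : Type u} {A : D.V → Set L}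
    (hA : ∀ v, (k : ℕ∞) ≤ (A v).encard) :
    ∃ A' : D.V → Set L, (∀ v, A' v ⊆ A v) ∧ (∀ v, Finite (A' v)) ∧ (∀ v, (A' v).encard = k) := by
  choose A' hA' hcard using fun v => Set.exists_subset_encard_eq (hA v)
  exact ⟨A', hA', fun v => Set.finite_of_encard_eq_coe (hcard v), hcard⟩

theorem DPColorable.listColorable (hP : IsReliable P) {k : ℕ} (h : DPColorable P D k) :
    ListColorable P D k := by
  intro L A hA
  obtain ⟨A', hsub, hfin, hcard⟩ := exists_finite_lists hA
  obtain ⟨T, hT, hTP⟩ := h (listCover D A') (listCover_isKCover A' fun v => by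
    rw [Set.ncard, hcard v]; exact le_rfl)
  obtain ⟨φ, hφ, hφP⟩ := exists_coloring_of_isTransversal A' hP hT hTP
  exact ⟨φ, fun v => hsub v (hφ v), hφP⟩

theorem colorable_of_coloring {k : ℕ} {φ : D.V → ULift.{u} (Fin k)}
    (hφ : ∀ c, D.induce (φ ⁻¹' {c}) ∈ P) : Colorable P D k := by
  refine ⟨fun v => (φ v).down, fun c => ?_⟩
  convert hφ ⟨c⟩ using 2
  ext v
  exact ⟨fun h => ULift.ext _ _ h, fun h => congrArg ULift.down h⟩

theorem encard_univ_ulift_fin (k : ℕ) : (Set.univ : Set (ULift.{u} (Fin k))).encard = k := by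
  rw [Set.encard_univ, ENat.card_eq_coe_natCard]
  simp

theorem ListColorable.colorable {k : ℕ} (h : ListColorable P D k) : Colorable P D k := by
  obtain ⟨φ, -, hφ⟩ := h (ULift (Fin k)) (fun _ => Set.univ) fun v => (encard_univ_ulift_fin k).ge
  exact colorable_of_coloring hφ

/-- By induction on the order: if all `D - v` are DP-`k`-colorable, then the degree bound holds for
every vertex. -/
theorem exists_mul_sBound_le_of_not_dpColorable (hP : IsReliable P) {k : ℕ} :
    ∀ (n : ℕ) (D : FinDigraph.{u}), Nat.card D.V = n → ¬ DPColorable P D k → ∀ s,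
      ∃ v, k * sBound P s ≤ D.sDeg s v := by
  intro n
  induction n with
  | zero =>
    intro D hD h
    refine absurd (fun C _ => ⟨∅, fun v => ?_, ?_⟩) h
    · exact ((Nat.card_eq_zero.1 hD).resolve_right (not_infinite_iff_finite.2 inferInstance)).elim v
    · exact mem_of_isEmpty hP ⟨fun x => x.2⟩
  | succ n ih =>
    intro D hD h s
    by_cases hdel : ∀ v, DPColorable P (D.del v) k
    · unfold DPColorable at h
      push Not at h
      obtain ⟨C, hk, hno⟩ := h
      have hno' : ¬ ∃ T, C.IsTransversal T ∧ C.H.induce T ∈ P := fun ⟨T, hT, hTP⟩ => hno T hT hTP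
      have : Nonempty D.V := (Nat.card_pos_iff.1 (by omega)).1
      exact ⟨Classical.arbitrary _, mul_sBound_le_sDeg hP hno' hk
        (fun v => (hdel v).exists_partial_transversal hP hk) s _⟩
    · push Not at hdel
      obtain ⟨v, hv⟩ := hdel
      have hcard : Nat.card (D.del v).V = n := by
        have h1 : ({v}ᶜ : Set D.V).ncard = n := by
          rw [Set.ncard_compl, Set.ncard_singleton, hD]
          omega
        exact h1
      obtain ⟨w, hw⟩ := ih (D.del v) hcard hv s
      refine ⟨w.1, hw.trans ?_⟩
      have h1 : (D.del v).sDeg s w = {y | y ∈ ({v}ᶜ : Set D.V) ∧ D.sAdj s w.1 y}.ncard :=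
        D.sDeg_induce s w
      rw [h1, sDeg_eq]
      exact Set.ncard_le_ncard (fun y hy => hy.2) (Set.toFinite _)

theorem sDeg_le_card (s : Bool) (v : D.V) : D.sDeg s v ≤ Nat.card D.V := by
  rw [sDeg_eq]
  exact Set.ncard_le_card _

/-- The set that defines `chiDP` is nonempty, so that `chiDP` is not a junk value; by
`DPColorable.listColorable` and `ListColorable.colorable` the same holds for the other parameters. -/
theorem exists_dpColorable (hP : IsReliable P) (hd : 1 ≤ dPlus P) (D : FinDigraph.{u}) :
    ∃ k, DPColorable P D k := by
  refine ⟨Nat.card D.V + 1, ?_⟩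
  by_contra h
  obtain ⟨v, hv⟩ := exists_mul_sBound_le_of_not_dpColorable hP _ D rfl h true
  have h1 := sDeg_le_card true v
  have h2 : Nat.card D.V + 1 ≤ (Nat.card D.V + 1) * sBound P true := Nat.le_mul_of_pos_right _ hd
  omega

section Parameters

variable (hP : IsReliable P) (hd : 1 ≤ dPlus P)

include hP hd

theorem dpColorable_of_chiDP_lt {k : ℕ} (h : chiDP P D < k + 1) : DPColorable P D k :=
  (Nat.sInf_mem (s := {k | DPColorable P D k}) (exists_dpColorable hP hd D)).mono
    (Nat.lt_succ_iff.1 h)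

theorem listColorable_of_chiList_lt {k : ℕ} (h : chiList P D < k + 1) : ListColorable P D k := by
  obtain ⟨l, hl⟩ := exists_dpColorable hP hd D
  exact (Nat.sInf_mem (s := {k | ListColorable P D k}) ⟨l, hl.listColorable hP⟩).mono
    (Nat.lt_succ_iff.1 h)

theorem colorable_of_chi_lt {k : ℕ} (h : chi P D < k + 1) : Colorable P D k := by
  obtain ⟨l, hl⟩ := exists_dpColorable hP hd D
  exact (Nat.sInf_mem (s := {k | Colorable P D k}) ⟨l, (hl.listColorable hP).colorable⟩).mono hP
    (Nat.lt_succ_iff.1 h)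

theorem exists_cover_of_crit_chiDP {k : ℕ} (hD : D ∈ Crit (chiDP P) (k + 1)) :
    ∃ C : D.Cover, C.IsKCover k ∧ (¬ ∃ T, C.IsTransversal T ∧ C.H.induce T ∈ P) ∧
      ∀ v, ∃ T, C.H.induce T ∈ P ∧ ∀ u ≠ v, (T ∩ C.X u).ncard = 1 := by
  obtain ⟨hchi, hlt⟩ := hD
  have hnot : ¬ DPColorable P D k := Nat.notMem_of_lt_sInf (s := {k | DPColorable P D k})
    (by change k < chiDP P D; omega)
  unfold DPColorable at hnot
  push Not at hnot
  obtain ⟨C, hk, hno⟩ := hnot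
  refine ⟨C, hk, fun ⟨T, hT, hTP⟩ => hno T hT hTP, fun v => ?_⟩
  exact (dpColorable_of_chiDP_lt hP hd (hlt {v}ᶜ (by simp))).exists_partial_transversal hP hk

theorem exists_listCover_of_crit {k : ℕ}
    (hD : D ∈ Crit (chi P) (k + 1) ∪ Crit (chiList P) (k + 1)) :
    ∃ C : D.Cover, C.IsListCover ∧ C.IsKCover k ∧
      (¬ ∃ T, C.IsTransversal T ∧ C.H.induce T ∈ P) ∧
      ∀ v, ∃ T, C.H.induce T ∈ P ∧ ∀ u ≠ v, (T ∩ C.X u).ncard = 1 := by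
  rcases hD with ⟨hchi, hlt⟩ | ⟨hchi, hlt⟩
  · have hnot : ¬ Colorable P D k := Nat.notMem_of_lt_sInf (s := {k | Colorable P D k})
      (by change k < chi P D; omega)
    refine ⟨listCover D fun _ => (Set.univ : Set (ULift.{u} (Fin k))), listCover_isListCover _,
      listCover_isKCover _ fun v => ?_, fun ⟨T, hT, hTP⟩ => ?_, fun v => ?_⟩
    · rw [Set.ncard, encard_univ_ulift_fin]
      exact le_rfl
    · obtain ⟨φ, -, hφ⟩ := exists_coloring_of_isTransversal _ hP hT hTP
      exact hnot (colorable_of_coloring hφ)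
    · obtain ⟨φ, hφ⟩ := colorable_of_chi_lt hP hd (hlt {v}ᶜ (by simp))
      refine exists_partial_transversal_of_coloring _ hP (φ := fun u => ⟨φ u⟩)
        (fun _ => Set.mem_univ _) fun c => ?_
      have h : (fun u => (⟨φ u⟩ : ULift.{u} (Fin k))) ⁻¹' {c} = φ ⁻¹' {c.down} :=
        Set.ext fun u => ⟨fun h => congrArg ULift.down h, fun h => ULift.ext _ _ h⟩
      exact h ▸ hφ c.down
  · have hnot : ¬ ListColorable P D k := Nat.notMem_of_lt_sInf (s := {k | ListColorable P D k})
      (by change k < chiList P D; omega)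
    unfold ListColorable at hnot
    push Not at hnot
    obtain ⟨L, A, hA, hno⟩ := hnot
    obtain ⟨A', hsub, hfin, hcard⟩ := exists_finite_lists hA
    refine ⟨listCover D A', listCover_isListCover _, listCover_isKCover _ fun v => ?_,
      fun ⟨T, hT, hTP⟩ => ?_, fun v => ?_⟩
    · rw [Set.ncard, hcard]
      exact le_rfl
    · obtain ⟨φ, hφ, hφP⟩ := exists_coloring_of_isTransversal _ hP hT hTP
      obtain ⟨c, hc⟩ := hno φ fun v => hsub v (hφ v)
      exact hc (hφP c)
    · obtain ⟨φ, hφ, hφP⟩ := listColorable_of_chiList_lt hP hd (hlt {v}ᶜ (by simp)) L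
        (fun u => A' u.1) fun u => (hcard u.1).ge
      exact exists_partial_transversal_of_coloring _ hP hφ hφP

omit hd in
theorem mul_sBound_le_of_chiDP {k : ℕ} (h : chiDP P D = k + 1) (s : Bool) :
    ∃ v, k * sBound P s ≤ D.sDeg s v :=
  exists_mul_sBound_le_of_not_dpColorable hP _ D rfl (Nat.notMem_of_lt_sInf
    (s := {k | DPColorable P D k}) (by change k < chiDP P D; omega)) s

end Parameters

theorem nonempty_of_no_transversal {C : D.Cover} (hP : IsReliable P)
    (hno : ¬ ∃ T, C.IsTransversal T ∧ C.H.induce T ∈ P) : Nonempty D.V := by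
  by_contra h
  rw [not_nonempty_iff] at h
  exact hno ⟨∅, fun v => h.elim v, mem_of_isEmpty hP ⟨fun x => x.2⟩⟩

end FinDigraph

/-! ### The corollary -/

theorem corollary3p9 (P : Set FinDigraph.{u}) (hP : FinDigraph.IsReliable P)
    (hd : (1, 1) ≤ FinDigraph.dPair P) (k : ℕ) :
    (∀ D ∈ FinDigraph.Crit (FinDigraph.chiDP P) (k + 1),
      k • FinDigraph.dPair P ≤ D.minDeg ∧
      ∀ B : (D.induce {v | D.deg v = k • FinDigraph.dPair P}).Subdigraph, FinDigraph.IsBlock B →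
        FinDigraph.IsDibrick P B.coe ∨ (∃ n, Even n ∧ B.coe.IsBidirectedCycle n) ∨
          B.coe.IsAntidirectedCycle) ∧
    (∀ D ∈ FinDigraph.Crit (FinDigraph.chi P) (k + 1) ∪
        FinDigraph.Crit (FinDigraph.chiList P) (k + 1),
      k • FinDigraph.dPair P ≤ D.minDeg ∧
      ∀ B : (D.induce {v | D.deg v = k • FinDigraph.dPair P}).Subdigraph, FinDigraph.IsBlock B →
        FinDigraph.IsDibrick P B.coe) ∧
    (∀ D : FinDigraph.{u}, (FinDigraph.chiDP P D : ℚ) ≤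
      min ((D.maxOutDeg : ℚ) / FinDigraph.dPlus P) ((D.maxInDeg : ℚ) / FinDigraph.dMinus P) + 1) := by
  have hdp : 1 ≤ FinDigraph.dPlus P := hd.1
  have hdm : 1 ≤ FinDigraph.dMinus P := hd.2
  refine ⟨fun D hD => ?_, fun D hD => ?_, fun D => ?_⟩
  · obtain ⟨C, hk, hno, hT⟩ := FinDigraph.exists_cover_of_crit_chiDP hP hdp hD
    have := FinDigraph.nonempty_of_no_transversal hP hno
    exact ⟨FinDigraph.smul_dPair_le_minDeg hP hno hk hT, fun B hB =>
      (FinDigraph.block_cases hP hno hk hT hB).imp_right And.right⟩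
  · obtain ⟨C, hlist, hk, hno, hT⟩ := FinDigraph.exists_listCover_of_crit hP hdp hD
    have := FinDigraph.nonempty_of_no_transversal hP hno
    exact ⟨FinDigraph.smul_dPair_le_minDeg hP hno hk hT, fun B hB =>
      (FinDigraph.block_cases hP hno hk hT hB).resolve_right fun h => h.1 hlist⟩
  · rcases hχ : FinDigraph.chiDP P D with _ | m
    · rw [Nat.cast_zero]
      positivity
    · obtain ⟨v, hv⟩ := FinDigraph.mul_sBound_le_of_chiDP hP hχ true
      obtain ⟨w, hw⟩ := FinDigraph.mul_sBound_le_of_chiDP hP hχ false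
      have h1 : m * FinDigraph.dPlus P ≤ D.maxOutDeg :=
        hv.trans (le_ciSup (f := D.outDeg) (Set.finite_range _).bddAbove v)
      have h2 : m * FinDigraph.dMinus P ≤ D.maxInDeg :=
        hw.trans (le_ciSup (f := D.inDeg) (Set.finite_range _).bddAbove w)
      rw [Nat.cast_succ]
      refine add_le_add_left (le_min ?_ ?_) 1
      · rw [le_div_iff₀ (by exact_mod_cast hdp)]
        exact_mod_cast h1
      · rw [le_div_iff₀ (by exact_mod_cast hdm)]
        exact_mod_cast h2
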